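/- Let $K$ be an algebraically closed field, $Q$ a finite quiver with vertices $e_1,\dots,e_n$ (identified with idempotents of $KQ$), and $\Lambda = KQ/I$ a finite dimensional algebra with $I$ an admissible ideal of the path algebra $KQ$. Let $J$ be the Jacobson radical of $\Lambda$ and assume $J^2=0$. For a dimension vector $\mathbf d=(d_1,\dots,d_n)\in\mathbb N_0^n$ let $\mathbf{Rep}_{\mathbf d}(\Lambda)$ be the affine variety, with its Zariski topology, of all families $x=(x_\alpha)_\alpha$ of linear maps $x_\alpha\colon K^{d_i}\to K^{d_j}$, one for each arrow $\alpha\colon e_i\to e_j$, that satisfy all relations in $I$; let $M(x)$ be the corresponding left $\Lambda$-module on $\bigoplus_i K^{d_i}$. For a finitely generated left $\Lambda$-module $M$ put $\underline{\dim}\,M=(\dim_K e_iM)_{i}$, $\operatorname{top}M=M/JM$, and let $\operatorname{soc}M$ be the sum of the simple submodules of $M$. Let $\textbf{Top-Soc}(\mathbf d)$ be the set of all pairs $(\underline{\dim}\operatorname{top}M,\underline{\dim}\operatorname{soc}M)$ with $\underline{\dim}\,M=\mathbf d$. For a finitely generated semisimple $\Lambda$-module $T$ let $\mathbf{Rep}^T_{\mathbf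 d}=\{x\in \mathbf{Rep}_{\mathbf d}(\Lambda) : \operatorname{top}M(x)\cong T\}$; $T$ is called realizable with respect to $\mathbf d$ if $\mathbf{Rep}^T_{\mathbf d}\neq\varnothing$. A module $U$ is called the generic socle of the modules in $\mathbf{Rep}^T_{\mathbf d}$ if $\operatorname{soc}M(x)\cong U$ for all $x$ in some dense, relatively open subset of $\mathbf{Rep}^T_{\mathbf d}$. **Theorem 3.6.** Let $T_1,T_2$ be finitely generated semisimple $\Lambda$-modules, both realizable with respect to $\mathbf d$. Then, for $i=1,2$, the modules in $\mathbf{Rep}^{T_i}_{\mathbf d}$ have a generic socle. If $U_i$ is this generic socle, then $(\underline{\dim}\,T_i,\underline{\dim}\,U_i)\in\textbf{Top-Soc}(\mathbf d)$ for $i=1,2$, and $$\mathbf{Rep}^{T_1}_{\mathbf d}\subseteq\overline{\mathbf{Rep}^{T_2}_{\mathbf d}}\iff(\underline{\dim}\,T_1,\underline{\dim}\,U_1)\ge(\underline{\dim}\,T_2,\underline{\dim}\,U_2),$$ where the closure is taken in $\mathbf{Rep}_{\mathbf d}(\Lambda)$ and $\ge$ is the componentwise order on $\mathbb N_0^n\times\mathbb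 N_0^n$. -/

import Mathlib

universe u v w z

namespace QuiverRep

noncomputable section

/-! ### The path algebra of a finite quiver -/

/-- Generators of the path algebra: the trivial paths `e i` and the arrows. -/
inductive Gen (V : Type v) [Quiver.{w} V] : Type (max v w)
  | vertex (i : V) : Gen V
  | arrow {i j : V} (a : i ⟶ j) : Gen V

/-- Defining relations of the path algebra `KQ`, where paths are composed from right to left
(so that representations are left modules): the `e i` are orthogonal idempotents with sum `1`,
and an arrow `a : i ⟶ j` satisfies `e j * a = a = a * e i`. -/
inductive Rel (K : Type u) [Field K] (V : Type v) [Quiver.{w} V] [Fintype V] :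
    FreeAlgebra K (Gen V) → FreeAlgebra K (Gen V) → Prop
  | idem (i : V) :
      Rel K V (FreeAlgebra.ι K (Gen.vertex i) * FreeAlgebra.ι K (Gen.vertex i))
        (FreeAlgebra.ι K (Gen.vertex i))
  | orth (i j : V) (h : i ≠ j) :
      Rel K V (FreeAlgebra.ι K (Gen.vertex i) * FreeAlgebra.ι K (Gen.vertex j)) 0
  | sum_one : Rel K V (∑ i : V, FreeAlgebra.ι K (Gen.vertex i)) 1
  | target {i j : V} (a : i ⟶ j) :
      Rel K V (FreeAlgebra.ι K (Gen.vertex j) * FreeAlgebra.ι K (Gen.arrow a))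
        (FreeAlgebra.ι K (Gen.arrow a))
  | source {i j : V} (a : i ⟶ j) :
      Rel K V (FreeAlgebra.ι K (Gen.arrow a) * FreeAlgebra.ι K (Gen.vertex i))
        (FreeAlgebra.ι K (Gen.arrow a))

/-- The path algebra `KQ` of the finite quiver `Q` with vertex set `V`. -/
abbrev PathAlgebra (K : Type u) [Field K] (V : Type v) [Quiver.{w} V] [Fintype V] :
    Type (max u v w) :=
  RingQuot (Rel K V)

section PathAlgebra

variable (K : Type u) [Field K] {V : Type v} [Quiver.{w} V] [Fintype V]

/-- The trivial path at the vertex `i`. -/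
def vertexElem (i : V) : PathAlgebra K V :=
  RingQuot.mkAlgHom K (Rel K V) (FreeAlgebra.ι K (Gen.vertex i))

/-- An arrow as an element of the path algebra. -/
def arrowElem {i j : V} (a : i ⟶ j) : PathAlgebra K V :=
  RingQuot.mkAlgHom K (Rel K V) (FreeAlgebra.ι K (Gen.arrow a))

/-- A path as an element of the path algebra. -/
def pathElem {i : V} : {j : V} → Quiver.Path i j → PathAlgebra K V
  | _, Quiver.Path.nil => vertexElem K i
  | _, Quiver.Path.cons p a => arrowElem K a * pathElem p

variable (V)

/-- The two-sided ideal of `KQ` generated by all paths of length `m`, i.e. the `m`-th power of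
the arrow ideal. -/
def pathIdeal (m : ℕ) : TwoSidedIdeal (PathAlgebra K V) :=
  TwoSidedIdeal.span {r | ∃ (i j : V) (p : Quiver.Path i j), p.length = m ∧ r = pathElem K p}

variable {V}

/-- Admissible ideals: those lying between some power of the arrow ideal and its square. -/
def IsAdmissible (I : TwoSidedIdeal (PathAlgebra K V)) : Prop :=
  I ≤ pathIdeal K V 2 ∧ ∃ m : ℕ, 2 ≤ m ∧ pathIdeal K V m ≤ I

end PathAlgebra

/-- An identification `Λ = KQ / I` with `I` an admissible ideal: a surjective algebra
homomorphism `KQ → Λ` whose kernel `I` is admissible. -/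
structure Presentation (K : Type u) [Field K] (V : Type v) [Quiver.{w} V] [Fintype V]
    (Λ : Type z) [Ring Λ] [Algebra K Λ] where
  toAlgHom : PathAlgebra K V →ₐ[K] Λ
  surjective : Function.Surjective toAlgHom
  admissible : IsAdmissible K (TwoSidedIdeal.ker toAlgHom)

/-! ### The space of tuples of matrices, with its Zariski topology -/

/-- The affine space of families `(x_a)` of linear maps `K ^ (d i) → K ^ (d j)`, written as
matrices, indexed by the arrows `a : i ⟶ j`. -/
def RepSpace (K : Type u) {V : Type v} [Quiver.{w} V] (d : V → ℕ) : Type (max u v w) :=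
  ∀ ⦃i j : V⦄, (i ⟶ j) → Matrix (Fin (d j)) (Fin (d i)) K

/-- Index set of the coordinates of `RepSpace K d`: an arrow `a : i ⟶ j` with a matrix
position. -/
abbrev Coord {V : Type v} [Quiver.{w} V] (d : V → ℕ) : Type (max v w) :=
  Σ (i : V) (j : V) (_ : i ⟶ j), Fin (d j) × Fin (d i)

/-- The coordinates of a point. -/
def RepSpace.coords {K : Type u} {V : Type v} [Quiver.{w} V] {d : V → ℕ} (x : RepSpace K d) :
    Coord d → K :=
  fun c => x c.2.2.1 c.2.2.2.1 c.2.2.2.2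

/-- The common zero locus of a set of polynomials in the matrix entries. -/
def zeroLocus {K : Type u} [Field K] {V : Type v} [Quiver.{w} V] {d : V → ℕ}
    (S : Set (MvPolynomial (Coord d) K)) : Set (RepSpace K d) :=
  {x | ∀ f ∈ S, MvPolynomial.eval x.coords f = 0}

/-- The Zariski topology: the closed sets are the zero loci of sets of polynomials. -/
instance zariskiTopology {K : Type u} [Field K] {V : Type v} [Quiver.{w} V] {d : V → ℕ} :
    TopologicalSpace (RepSpace K d) :=
  TopologicalSpace.ofClosed {Z | ∃ S : Set (MvPolynomial (Coord d) K), Z = zeroLocus S}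
    ⟨{1}, by ext x; simp [zeroLocus]⟩
    (by
      intro A hA
      refine ⟨{f | ∃ S : Set (MvPolynomial (Coord d) K), zeroLocus S ∈ A ∧ f ∈ S}, ?_⟩
      ext x
      constructor
      · rintro hx f ⟨S, hS, hf⟩
        exact hx _ hS f hf
      · intro hx Z hZ
        obtain ⟨S, rfl⟩ := hA hZ
        exact fun f hf => hx f ⟨S, hZ, hf⟩)
    (by
      rintro _ ⟨S, rfl⟩ _ ⟨S', rfl⟩
      refine ⟨{h | ∃ f ∈ S, ∃ g ∈ S', h = f * g}, ?_⟩
      ext x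
      constructor
      · rintro (hx | hx) _ ⟨f, hf, g, hg, rfl⟩
        · simp [hx f hf]
        · simp [hx g hg]
      · intro hx
        by_contra hcon
        simp only [zeroLocus, Set.mem_union, Set.mem_ofPred_eq, not_or, not_forall] at hcon
        obtain ⟨⟨f, hf, hfx⟩, g, hg, hgx⟩ := hcon
        have h := hx (f * g) ⟨f, hf, g, hg, rfl⟩
        rw [map_mul] at h
        exact (mul_ne_zero hfx hgx) h)

/-! ### The representation variety -/

section Rep

variable {K : Type u} [Field K] {V : Type v} [Quiver.{w} V] [Fintype V] [DecidableEq V]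

/-- The operators on `⨁ i, K ^ (d i)` by which the generators act: `e i` is the projection onto
the `i`-th summand, and an arrow `a : i ⟶ j` acts by `x a` from the `i`-th to the `j`-th one. -/
def genAction {d : V → ℕ} (x : RepSpace K d) :
    Gen V → Module.End K (∀ i : V, Fin (d i) → K)
  | Gen.vertex i => (LinearMap.single K (fun i : V => Fin (d i) → K) i) ∘ₗ (LinearMap.proj i)
  | Gen.arrow (i := i) (j := j) a =>
      (LinearMap.single K (fun i : V => Fin (d i) → K) j) ∘ₗ (x a).mulVecLin ∘ₗ
        (LinearMap.proj i)

/-- The action of the path algebra on `⨁ i, K ^ (d i)` given by the tuple `x`. -/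
def pathAction {d : V → ℕ} (x : RepSpace K d) :
    PathAlgebra K V →ₐ[K] Module.End K (∀ i : V, Fin (d i) → K) :=
  RingQuot.liftAlgHom K ⟨FreeAlgebra.lift K (genAction x), by
    intro p q h
    cases h with
    | idem i => ext; simp [genAction]
    | orth i j h =>
      refine LinearMap.ext fun f => ?_
      simp [genAction, Pi.single_eq_of_ne h]
    | sum_one =>
      refine LinearMap.ext fun f => ?_
      simp [genAction, LinearMap.sum_apply, Finset.univ_sum_single]
    | target a =>
      refine LinearMap.ext fun f => ?_
      simp [genAction]
    | source a =>
      refine LinearMap.ext fun f => ?_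
      simp [genAction]⟩

variable {Λ : Type z} [Ring Λ] [Algebra K Λ] (P : Presentation K V Λ)

/-- The affine variety `Rep_d(Λ)`: all tuples `x` satisfying all relations in
`I = ker (KQ → Λ)`; it carries the (subspace) Zariski topology. -/
abbrev RepVariety (d : V → ℕ) : Type (max u v w) :=
  {x : RepSpace K d // ∀ r : PathAlgebra K V, P.toAlgHom r = 0 → pathAction x r = 0}

theorem pathAction_eq_of_eq {d : V → ℕ} (x : RepVariety P d) {r s : PathAlgebra K V}
    (h : P.toAlgHom r = P.toAlgHom s) : pathAction x.1 r = pathAction x.1 s := by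
  rw [← sub_eq_zero, ← map_sub]
  exact x.2 _ (by rw [map_sub, h, sub_self])

/-- The action of `Λ` on `⨁ i, K ^ (d i)` given by a point `x` of `Rep_d(Λ)`: the homomorphism
through which the action of `KQ` given by `x` factors. -/
def algAction {d : V → ℕ} (x : RepVariety P d) :
    Λ →ₐ[K] Module.End K (∀ i : V, Fin (d i) → K) :=
  AlgHom.ofLinearMap
    { toFun := fun a => pathAction x.1 (Function.surjInv P.surjective a)
      map_add' := fun a b => by
        rw [← map_add]
        exact pathAction_eq_of_eq P x (by simp [Function.surjInv_eq])
      map_smul' := fun c a => by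
        rw [RingHom.id_apply, ← map_smul]
        exact pathAction_eq_of_eq P x (by simp [Function.surjInv_eq]) }
    (by
      refine (pathAction_eq_of_eq P x ?_).trans (map_one (pathAction x.1))
      simp [Function.surjInv_eq])
    (fun a b => by
      refine (pathAction_eq_of_eq P x ?_).trans (map_mul (pathAction x.1) _ _)
      simp [Function.surjInv_eq])

theorem algAction_apply {d : V → ℕ} (x : RepVariety P d) (r : PathAlgebra K V) :
    algAction P x (P.toAlgHom r) = pathAction x.1 r :=
  pathAction_eq_of_eq P x (Function.surjInv_eq P.surjective _)

/-- The left `Λ`-module `M(x)` with underlying space `⨁ i, K ^ (d i)`. -/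
def RepModule {d : V → ℕ} (_x : RepVariety P d) : Type (max u v) :=
  ∀ i : V, Fin (d i) → K

instance {d : V → ℕ} (x : RepVariety P d) : AddCommGroup (RepModule P x) :=
  inferInstanceAs (AddCommGroup (∀ i : V, Fin (d i) → K))

instance {d : V → ℕ} (x : RepVariety P d) : Module K (RepModule P x) :=
  inferInstanceAs (Module K (∀ i : V, Fin (d i) → K))

instance {d : V → ℕ} (x : RepVariety P d) : Module Λ (RepModule P x) :=
  Module.compHom (∀ i : V, Fin (d i) → K) (algAction P x).toRingHom

theorem repModule_smul_def {d : V → ℕ} (x : RepVariety P d) (r : Λ) (m : RepModule P x) :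
    r • m = algAction P x r m := rfl

instance {d : V → ℕ} (x : RepVariety P d) : IsScalarTower K Λ (RepModule P x) where
  smul_assoc c r m := by
    rw [repModule_smul_def, repModule_smul_def, map_smul]
    rfl

/-! ### Tops, socles, dimension vectors -/

/-- `dim M`: the vector of the dimensions of the spaces `e i M`. -/
def dimVec (M : Type*) [AddCommGroup M] [Module K M] [Module Λ M] [IsScalarTower K Λ M] :
    V → ℕ :=
  fun i => Module.finrank K
    (LinearMap.range (Algebra.lsmul K K M (P.toAlgHom (vertexElem K i))))

/-- `top M = M / J M`, with `J` the Jacobson radical of `Λ`. -/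
abbrev top (Λ : Type*) [Ring Λ] (M : Type*) [AddCommGroup M] [Module Λ M] : Type _ :=
  M ⧸ (Ring.jacobson Λ • (⊤ : Submodule Λ M))

/-- `soc M`, the sum of all simple submodules. -/
def socle (Λ : Type*) [Ring Λ] (M : Type*) [AddCommGroup M] [Module Λ M] : Submodule Λ M :=
  sSup {S : Submodule Λ M | IsSimpleModule Λ S}

/-- `Rep^T_d`: the points `x` of `Rep_d(Λ)` such that `M(x)` has top `T`. -/
def stratum (d : V → ℕ) (T : Type*) [AddCommGroup T] [Module Λ T] : Set (RepVariety P d) :=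
  {x | Nonempty (top Λ (RepModule P x) ≃ₗ[Λ] T)}

/-- `T` is realizable with respect to `d`. -/
def IsRealizable (d : V → ℕ) (T : Type*) [AddCommGroup T] [Module Λ T] : Prop :=
  (stratum P d T).Nonempty

/-- `U` is the generic socle of the modules in `X`: there is a dense, relatively open subset
`O` of `X` such that `M(x)` has socle `U` for all `x ∈ O`. -/
def IsGenericSocle {d : V → ℕ} (X : Set (RepVariety P d))
    (U : Type*) [AddCommGroup U] [Module Λ U] : Prop :=
  ∃ O : Set (RepVariety P d), (∃ W : Set (RepVariety P d), IsOpen W ∧ O = X ∩ W) ∧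
    X ⊆ closure O ∧ ∀ x ∈ O, Nonempty (socle Λ (RepModule P x) ≃ₗ[Λ] U)

/-- `Top-Soc(d)`: all pairs `(dim top M, dim soc M)`, where `M` runs through the finitely
generated left `Λ`-modules with dimension vector `d`. (The universe is that of the modules
`M(x)`, so all such modules occur up to isomorphism.) -/
def TopSoc (d : V → ℕ) : Set ((V → ℕ) × (V → ℕ)) :=
  {p | ∃ (M : Type (max u v)) (_ : AddCommGroup M) (_ : Module K M) (_ : Module Λ M)
      (_ : IsScalarTower K Λ M), Module.Finite Λ M ∧ dimVec P M = d ∧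
      p = (dimVec P (top Λ M), dimVec P (socle Λ M))}

end Rep

end

end QuiverRep

/-! Since `J ^ 2 = 0`, a tuple `x` lies in the representation variety exactly when its radical is
contained in its socle at every vertex. A module killed by `J` is just a vector space graded by the
vertices, so tops and socles are classified by their dimension vectors, and a stratum is the locus
where the numbers `dim radSpace x j` have prescribed values.

For a family `B` of subspaces, `layer B` is the set of tuples with radical inside `B` and socle
containing `B`. It is a linear subspace of the representation space, hence irreducible, and it lies
in the variety. If `dim B` equals the radical dimensions of a stratum, base change moves points of
that stratum into `layer B`; as radical ranks are lower semicontinuous, the stratum is then dense in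
the layer (`exists_mem_stratum_of_mem_layer`).

Socle dimensions are upper semicontinuous. By irreducibility of the layers, their minima over a
stratum are attained at all vertices at once on a dense open subset, which gives the generic socle
(`exists_dense_minimal_socSpace`). Semicontinuity also gives the forward implication. Conversely,
for generic `x`, `y` in the two strata the inequalities read `dim rad x ≤ dim rad y ≤ dim soc y ≤
dim soc x`. So there is a `B` between `rad x` and `soc x` of dimension `dim rad y`, and `x` lies in
a layer in which the second stratum is dense (`mem_closure_stratum`). -/

namespace QuiverRep

noncomputable section

/-! ### Paths and the radical -/

section PathAlgebra

variable {K : Type u} [Field K] {V : Type v} [Quiver.{w} V] [Fintype V]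

theorem vertexElem_mul_self (i : V) : vertexElem K i * vertexElem K i = vertexElem K i := by
  simpa [vertexElem] using RingQuot.mkAlgHom_rel K (Rel.idem (K := K) i)

theorem vertexElem_mul_of_ne {i j : V} (h : i ≠ j) : vertexElem K i * vertexElem K j = 0 := by
  simpa [vertexElem] using RingQuot.mkAlgHom_rel K (Rel.orth (K := K) i j h)

variable (K V) in
theorem sum_vertexElem : ∑ i : V, vertexElem K i = 1 := by
  simpa [vertexElem] using RingQuot.mkAlgHom_rel K (Rel.sum_one (K := K) (V := V))

theorem vertexElem_mul_arrowElem {i j : V} (a : i ⟶ j) :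
    vertexElem K j * arrowElem K a = arrowElem K a := by
  simpa [vertexElem, arrowElem] using RingQuot.mkAlgHom_rel K (Rel.target (K := K) a)

theorem arrowElem_mul_vertexElem {i j : V} (a : i ⟶ j) :
    arrowElem K a * vertexElem K i = arrowElem K a := by
  simpa [vertexElem, arrowElem] using RingQuot.mkAlgHom_rel K (Rel.source (K := K) a)

theorem vertexElem_mul_pathElem {i j : V} (p : Quiver.Path i j) :
    vertexElem K j * pathElem K p = pathElem K p := by
  cases p with
  | nil => exact vertexElem_mul_self i
  | cons p a => rw [pathElem, ← mul_assoc, vertexElem_mul_arrowElem]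

theorem pathElem_mul_vertexElem {i j : V} (p : Quiver.Path i j) :
    pathElem K p * vertexElem K i = pathElem K p := by
  induction p with
  | nil => exact vertexElem_mul_self i
  | cons p a ih => rw [pathElem, mul_assoc, ih]

theorem pathElem_mul_pathElem {i j k : V} (p : Quiver.Path i j) (q : Quiver.Path j k) :
    pathElem K q * pathElem K p = pathElem K (p.comp q) := by
  induction q with
  | nil => exact vertexElem_mul_pathElem p
  | cons q a ih => rw [Quiver.Path.comp_cons, pathElem, pathElem, mul_assoc, ih]

theorem pathElem_mul_pathElem_of_ne {i j k l : V} (p : Quiver.Path i j) (q : Quiver.Path k l)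
    (h : k ≠ j) : pathElem K q * pathElem K p = 0 := by
  rw [← pathElem_mul_vertexElem q, ← vertexElem_mul_pathElem p, mul_assoc,
    ← mul_assoc (vertexElem K k), vertexElem_mul_of_ne h, zero_mul, mul_zero]

variable (K V) in
/-- The linear span of the paths of length at least `k`. -/
def pathSpan (k : ℕ) : Submodule K (PathAlgebra K V) :=
  Submodule.span K {r | ∃ (i j : V) (p : Quiver.Path i j), k ≤ p.length ∧ r = pathElem K p}

theorem pathElem_mem_pathSpan {k : ℕ} {i j : V} (p : Quiver.Path i j) (h : k ≤ p.length) :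
    pathElem K p ∈ pathSpan K V k :=
  Submodule.subset_span ⟨i, j, p, h, rfl⟩

theorem arrowElem_eq_pathElem {i j : V} (a : i ⟶ j) :
    arrowElem K a = pathElem K a.toPath :=
  (arrowElem_mul_vertexElem a).symm

theorem mul_mem_pathSpan {k l : ℕ} {r s : PathAlgebra K V} (hr : r ∈ pathSpan K V k)
    (hs : s ∈ pathSpan K V l) : r * s ∈ pathSpan K V (k + l) := by
  have h : pathSpan K V k * pathSpan K V l ≤ pathSpan K V (k + l) := by
    rw [pathSpan, pathSpan, Submodule.span_mul_span, Submodule.span_le]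
    rintro _ ⟨_, ⟨i, j, p, hp, rfl⟩, _, ⟨i', j', q, hq, rfl⟩, rfl⟩
    by_cases h : i = j'
    · subst h
      simp only [pathElem_mul_pathElem]
      exact pathElem_mem_pathSpan _ (by rw [Quiver.Path.length_comp]; omega)
    · simp only [pathElem_mul_pathElem_of_ne q p h]
      exact zero_mem _
  exact h (Submodule.mul_mem_mul hr hs)

theorem pathSpan_zero : pathSpan K V 0 = ⊤ := by
  have one : (1 : PathAlgebra K V) ∈ pathSpan K V 0 := by
    rw [← sum_vertexElem K V]
    exact Submodule.sum_mem _ fun i _ => pathElem_mem_pathSpan (Quiver.Path.nil : Quiver.Path i i)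
      (Nat.zero_le _)
  refine (Submodule.eq_top_iff').2 fun r => ?_
  obtain ⟨f, rfl⟩ := RingQuot.mkAlgHom_surjective K (Rel K V) r
  induction f using FreeAlgebra.induction with
  | grade0 c =>
    rw [AlgHom.commutes, Algebra.algebraMap_eq_smul_one]
    exact Submodule.smul_mem _ _ one
  | grade1 g =>
    cases g with
    | vertex i =>
      have h : vertexElem K i ∈ pathSpan K V 0 :=
        pathElem_mem_pathSpan (Quiver.Path.nil : Quiver.Path i i) (Nat.zero_le _)
      exact h
    | arrow a =>
      have h : arrowElem K a ∈ pathSpan K V 0 :=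
        arrowElem_eq_pathElem (K := K) a ▸ pathElem_mem_pathSpan a.toPath (Nat.zero_le _)
      exact h
  | mul f g hf hg =>
    rw [map_mul]
    exact mul_mem_pathSpan (k := 0) (l := 0) hf hg
  | add f g hf hg =>
    rw [map_add]
    exact add_mem hf hg

theorem mul_mem_pathSpan_one (r : PathAlgebra K V) {s : PathAlgebra K V}
    (hs : s ∈ pathSpan K V 1) : r * s ∈ pathSpan K V 1 := by
  simpa using mul_mem_pathSpan (pathSpan_zero (K := K) (V := V) ▸ Submodule.mem_top : r ∈ _) hs

theorem pow_mem_pathSpan {r : PathAlgebra K V} (hr : r ∈ pathSpan K V 1) (m : ℕ) :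
    r ^ m ∈ pathSpan K V m := by
  induction m with
  | zero => rw [pathSpan_zero]; trivial
  | succ m ih => rw [pow_succ]; exact mul_mem_pathSpan ih hr

theorem pathElem_mem_pathIdeal {m : ℕ} {i j : V} (p : Quiver.Path i j) (h : m ≤ p.length) :
    pathElem K p ∈ pathIdeal K V m := by
  induction p with
  | nil => exact TwoSidedIdeal.subset_span ⟨i, i, Quiver.Path.nil, (Nat.le_zero.1 h).symm, rfl⟩
  | cons p a ih =>
    rcases h.eq_or_lt with h | h
    · exact TwoSidedIdeal.subset_span ⟨_, _, p.cons a, h.symm, rfl⟩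
    · exact TwoSidedIdeal.mul_mem_left _ _ _ (ih (by simpa [Nat.lt_succ_iff] using h))

theorem smul_mem_twoSidedIdeal {A : Type*} [Ring A] [Algebra K A] (I : TwoSidedIdeal A) (c : K)
    {r : A} (hr : r ∈ I) : c • r ∈ I := by
  rw [← one_mul r, ← smul_mul_assoc]
  exact I.mul_mem_left _ _ hr

theorem mem_pathIdeal_of_mem_pathSpan {m : ℕ} {r : PathAlgebra K V} (hr : r ∈ pathSpan K V m) :
    r ∈ pathIdeal K V m := by
  induction hr using Submodule.span_induction with
  | mem r hr =>
    obtain ⟨i, j, p, hp, rfl⟩ := hr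
    exact pathElem_mem_pathIdeal p hp
  | zero => exact zero_mem _
  | add r s _ _ hr hs => exact add_mem hr hs
  | smul c r _ hr => exact smul_mem_twoSidedIdeal _ c hr

/-- The trivial paths complement the arrow ideal. Once the latter acts as zero, only the idempotents
have to be considered. -/
theorem exists_eq_sum_vertexElem_add (r : PathAlgebra K V) :
    ∃ c : V → K, ∃ s ∈ pathSpan K V 1, r = ∑ i, c i • vertexElem K i + s := by
  classical
  have hr : r ∈ pathSpan K V 0 := pathSpan_zero (K := K) (V := V) ▸ Submodule.mem_top
  induction hr using Submodule.span_induction with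
  | mem r hr =>
    obtain ⟨i, j, p, -, rfl⟩ := hr
    cases p with
    | nil =>
      refine ⟨Pi.single i 1, 0, zero_mem _, ?_⟩
      rw [Finset.sum_eq_single i]
      · simp [pathElem]
      · intro j _ h
        simp [Pi.single_eq_of_ne h]
      · simp
    | cons p a => exact ⟨0, _, pathElem_mem_pathSpan (p.cons a) (by simp), by simp⟩
  | zero => exact ⟨0, 0, zero_mem _, by simp⟩
  | add r s _ _ hr hs =>
    obtain ⟨c, r', hr', rfl⟩ := hr
    obtain ⟨c', s', hs', rfl⟩ := hs
    refine ⟨c + c', r' + s', add_mem hr' hs', ?_⟩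
    simp only [Pi.add_apply, add_smul, Finset.sum_add_distrib]
    abel
  | smul b r _ hr =>
    obtain ⟨c, r', hr', rfl⟩ := hr
    exact ⟨b • c, b • r', Submodule.smul_mem _ _ hr', by
      simp [smul_add, Finset.smul_sum, smul_smul]⟩

/-! ### The Jacobson radical of an admissible quotient -/

variable {Λ : Type z} [Ring Λ] [Algebra K Λ] (P : Presentation K V Λ)

theorem Presentation.mem_ker_of_mem_ideal {r : PathAlgebra K V}
    (hr : r ∈ TwoSidedIdeal.ker P.toAlgHom) : P.toAlgHom r = 0 := by
  simpa [TwoSidedIdeal.mem_ker] using hr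

theorem Presentation.isNilpotent_of_mem_pathSpan {r : PathAlgebra K V}
    (hr : r ∈ pathSpan K V 1) : IsNilpotent (P.toAlgHom r) := by
  obtain ⟨m, -, hm⟩ := P.admissible.2
  refine ⟨m, ?_⟩
  rw [← map_pow]
  exact P.mem_ker_of_mem_ideal (hm (mem_pathIdeal_of_mem_pathSpan (pow_mem_pathSpan hr m)))

/-- The arrow ideal is stable under left multiplication and has nilpotent image, so `1 + y * r` is
invertible in `Λ` for every `y`. -/
theorem Presentation.mem_jacobson_of_mem_pathSpan {r : PathAlgebra K V}
    (hr : r ∈ pathSpan K V 1) : P.toAlgHom r ∈ Ring.jacobson Λ := by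
  rw [← Ideal.jacobson_bot, Ideal.mem_jacobson_iff]
  intro y
  obtain ⟨s, rfl⟩ := P.surjective y
  obtain ⟨u, hu⟩ := (P.isNilpotent_of_mem_pathSpan (mul_mem_pathSpan_one s hr)).isUnit_one_add
  refine ⟨↑u⁻¹, ?_⟩
  have h := u.inv_mul
  rw [hu, map_mul, mul_add, mul_one] at h
  rw [Ideal.mem_bot, mul_assoc, add_comm, h, sub_self]

theorem eq_zero_of_isIdempotentElem_of_mem_jacobson {A : Type*} [Ring A] {e : A}
    (he : e * e = e) (h : e ∈ Ring.jacobson A) : e = 0 := by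
  rw [← Ideal.jacobson_bot, Ideal.mem_jacobson_iff] at h
  -- With `-1` this says `z * (1 - e) = 1`; multiplying by `e` on the right gives `0 = e`.
  obtain ⟨z, hz⟩ := h (-1)
  rw [Ideal.mem_bot] at hz
  have : (z * -1 * e + z - 1) * e = 0 := by rw [hz, zero_mul]
  have h2 : (z * -1 * e + z - 1) * e = -(z * (e * e)) + z * e - e := by noncomm_ring
  rw [h2, he] at this
  simpa using this

/-- If a trivial path occurred with nonzero coefficient, multiplying by it would put its image, an
idempotent, into the radical. That image is therefore zero and the term can be dropped. -/
theorem Presentation.exists_mem_pathSpan_of_mem_jacobson {a : Λ} (ha : a ∈ Ring.jacobson Λ) :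
    ∃ s ∈ pathSpan K V 1, P.toAlgHom s = a := by
  classical
  obtain ⟨r, rfl⟩ := P.surjective a
  obtain ⟨c, s, hs, rfl⟩ := exists_eq_sum_vertexElem_add r
  refine ⟨s, hs, ?_⟩
  rw [map_add, right_eq_add]
  have h1 : P.toAlgHom (∑ i, c i • vertexElem K i) ∈ Ring.jacobson Λ := by
    have := sub_mem ha (P.mem_jacobson_of_mem_pathSpan hs)
    simpa using this
  rw [map_sum]
  refine Finset.sum_eq_zero fun i _ => ?_
  by_cases hc : c i = 0
  · simp [hc]
  have h2 : vertexElem K i * ∑ j, c j • vertexElem K j = c i • vertexElem K i := by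
    rw [Finset.mul_sum, Finset.sum_eq_single i]
    · rw [mul_smul_comm, vertexElem_mul_self]
    · intro j _ hj
      rw [mul_smul_comm, vertexElem_mul_of_ne hj.symm, smul_zero]
    · simp
  have h3 : P.toAlgHom (vertexElem K i) ∈ Ring.jacobson Λ := by
    have h4 := (Ring.jacobson Λ).mul_mem_left (P.toAlgHom ((c i)⁻¹ • vertexElem K i)) h1
    rwa [← map_mul, smul_mul_assoc, h2, smul_smul, inv_mul_cancel₀ hc, one_smul] at h4
  rw [map_smul, eq_zero_of_isIdempotentElem_of_mem_jacobson
    (by rw [← map_mul, vertexElem_mul_self]) h3, smul_zero]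

theorem Presentation.map_arrowElem_mem_jacobson {i j : V} (a : i ⟶ j) :
    P.toAlgHom (arrowElem K a) ∈ Ring.jacobson Λ :=
  P.mem_jacobson_of_mem_pathSpan
    (arrowElem_eq_pathElem (K := K) a ▸ pathElem_mem_pathSpan a.toPath le_rfl)

end PathAlgebra

/-! ### Modules annihilated by the radical -/

section Modules

variable {K : Type u} [Field K] {V : Type v} [Quiver.{w} V] [Fintype V]
variable {Λ : Type z} [Ring Λ] [Algebra K Λ] (P : Presentation K V Λ)

section

variable {M : Type*} [AddCommGroup M] [Module K M] [Module Λ M] [IsScalarTower K Λ M]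
  {N : Type*} [AddCommGroup N] [Module K N] [Module Λ N] [IsScalarTower K Λ N]

omit [Module K M] [IsScalarTower K Λ M] in
theorem Presentation.sum_vertexElem_smul (m : M) :
    ∑ i, P.toAlgHom (vertexElem K i) • m = m := by
  rw [← Finset.sum_smul, ← map_sum, sum_vertexElem, map_one, one_smul]

theorem dimVec_congr (e : M ≃ₗ[Λ] N) : dimVec P M = dimVec P N := by
  funext i
  rw [dimVec, dimVec, ← LinearEquiv.finrank_map_eq (e.restrictScalars K)]
  suffices h : (LinearMap.range (Algebra.lsmul K K M (P.toAlgHom (vertexElem K i)))).map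
      (e.restrictScalars K).toLinearMap =
      LinearMap.range (Algebra.lsmul K K N (P.toAlgHom (vertexElem K i))) by
    rw [← h]
  ext n
  constructor
  · rintro ⟨_, ⟨m, rfl⟩, rfl⟩
    exact ⟨e m, by simp⟩
  · rintro ⟨n, rfl⟩
    exact ⟨_, ⟨e.symm n, rfl⟩, by simp⟩

theorem Presentation.exists_smul_eq_sum (m : M) (hm : ∀ a ∈ Ring.jacobson Λ, a • m = 0) (r : Λ) :
    ∃ c : V → K, r • m = ∑ i, c i • P.toAlgHom (vertexElem K i) • m := by
  classical
  obtain ⟨r, rfl⟩ := P.surjective r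
  obtain ⟨c, s, hs, rfl⟩ := exists_eq_sum_vertexElem_add r
  refine ⟨c, ?_⟩
  rw [map_add, add_smul, hm _ (P.mem_jacobson_of_mem_pathSpan hs), add_zero, map_sum,
    Finset.sum_smul]
  simp only [map_smul, smul_assoc]

/-- Linear maps between the spaces attached to the vertices assemble to a homomorphism between
modules annihilated by the Jacobson radical. -/
theorem Presentation.exists_linearMap_of_vertex_maps
    (hM : ∀ a ∈ Ring.jacobson Λ, ∀ m : M, a • m = 0)
    (hN : ∀ a ∈ Ring.jacobson Λ, ∀ n : N, a • n = 0)
    (ψ : ∀ i, LinearMap.range (Algebra.lsmul K K M (P.toAlgHom (vertexElem K i))) →ₗ[K]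
      LinearMap.range (Algebra.lsmul K K N (P.toAlgHom (vertexElem K i)))) :
    ∃ f : M →ₗ[Λ] N, ∀ i m, P.toAlgHom (vertexElem K i) • f m =
      ψ i ⟨P.toAlgHom (vertexElem K i) • m, m, rfl⟩ := by
  let f : M →ₗ[K] N := ∑ i, (Submodule.subtype _) ∘ₗ ψ i ∘ₗ
    (Algebra.lsmul K K M (P.toAlgHom (vertexElem K i))).rangeRestrict
  have hf : ∀ m, f m = ∑ i, (ψ i ⟨P.toAlgHom (vertexElem K i) • m, m, rfl⟩ : N) := by
    intro m
    simp only [f, LinearMap.sum_apply]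
    rfl
  have key : ∀ i m, P.toAlgHom (vertexElem K i) • f m =
      ψ i ⟨P.toAlgHom (vertexElem K i) • m, m, rfl⟩ := by
    intro i m
    rw [hf, Finset.smul_sum, Finset.sum_eq_single i]
    · obtain ⟨n, hn⟩ := (ψ i ⟨P.toAlgHom (vertexElem K i) • m, m, rfl⟩).2
      rw [← hn, Algebra.lsmul_coe, smul_smul, ← map_mul, vertexElem_mul_self]
    · intro j _ hj
      obtain ⟨n, hn⟩ := (ψ j ⟨P.toAlgHom (vertexElem K j) • m, m, rfl⟩).2
      rw [← hn, Algebra.lsmul_coe, smul_smul, ← map_mul, vertexElem_mul_of_ne hj.symm, map_zero,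
        zero_smul]
    · simp
  refine ⟨{ f with map_smul' := fun r m => ?_ }, key⟩
  obtain ⟨r, rfl⟩ := P.surjective r
  obtain ⟨c, s, hs, rfl⟩ := exists_eq_sum_vertexElem_add r
  -- The radical part acts as zero on both modules, so linearity need only be checked on the
  -- idempotents.
  have hs' := P.mem_jacobson_of_mem_pathSpan hs
  change f _ = P.toAlgHom _ • f m
  rw [map_add, add_smul, add_smul, hM _ hs', hN _ hs', add_zero, add_zero, map_sum, Finset.sum_smul,
    Finset.sum_smul, map_sum]
  refine Finset.sum_congr rfl fun i _ => ?_
  rw [map_smul P.toAlgHom, smul_assoc, smul_assoc, map_smul f, key, hf, Finset.sum_eq_single i]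
  · congr 3
    refine Subtype.ext ?_
    change P.toAlgHom _ • P.toAlgHom _ • m = P.toAlgHom _ • m
    rw [smul_smul, ← map_mul, vertexElem_mul_self]
  · intro j _ hj
    have : (⟨P.toAlgHom (vertexElem K j) • P.toAlgHom (vertexElem K i) • m, _, rfl⟩ :
        LinearMap.range (Algebra.lsmul K K M (P.toAlgHom (vertexElem K j)))) = 0 := by
      refine Subtype.ext ?_
      change P.toAlgHom _ • P.toAlgHom _ • m = 0
      rw [smul_smul, ← map_mul, vertexElem_mul_of_ne hj, map_zero, zero_smul]
    rw [this, map_zero, Submodule.coe_zero]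
  · simp

/-- Applied to tops and socles, this turns statements about isomorphism classes into statements
about dimensions. -/
theorem Presentation.nonempty_linearEquiv_of_dimVec_eq [Module.Finite K M] [Module.Finite K N]
    (hM : ∀ a ∈ Ring.jacobson Λ, ∀ m : M, a • m = 0)
    (hN : ∀ a ∈ Ring.jacobson Λ, ∀ n : N, a • n = 0) (h : dimVec P M = dimVec P N) :
    Nonempty (M ≃ₗ[Λ] N) := by
  let φ := fun i => LinearEquiv.ofFinrankEq (R := K) _ _ (congrFun h i)
  obtain ⟨f, hf⟩ := P.exists_linearMap_of_vertex_maps hM hN fun i => (φ i).toLinearMap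
  obtain ⟨g, hg⟩ := P.exists_linearMap_of_vertex_maps hN hM fun i => (φ i).symm.toLinearMap
  refine ⟨LinearEquiv.ofLinearMap f g (LinearMap.ext fun n => ?_) (LinearMap.ext fun m => ?_)⟩
  · rw [LinearMap.comp_apply, LinearMap.id_apply, ← P.sum_vertexElem_smul (f (g n)),
      ← P.sum_vertexElem_smul n]
    refine Finset.sum_congr rfl fun i _ => ?_
    rw [hf]
    simp only [P.sum_vertexElem_smul, hg]
    simp
  · rw [LinearMap.comp_apply, LinearMap.id_apply, ← P.sum_vertexElem_smul (g (f m)),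
      ← P.sum_vertexElem_smul m]
    refine Finset.sum_congr rfl fun i _ => ?_
    rw [hg]
    simp only [P.sum_vertexElem_smul, hf]
    simp

theorem smul_eq_zero_of_mem_socle {A M : Type*} [Ring A] [AddCommGroup M] [Module A M] {m : M}
    (hm : m ∈ socle A M) {a : A} (ha : a ∈ Ring.jacobson A) : a • m = 0 := by
  rw [socle, sSup_eq_iSup'] at hm
  induction hm using Submodule.iSup_induction' with
  | mem S m hm =>
    have : IsSimpleModule A S.1 := S.2
    have h := Module.mem_annihilator.1 (IsSemisimpleModule.jacobson_le_annihilator A S.1 ha) ⟨m, hm⟩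
    simpa using congrArg Subtype.val h
  | zero => exact smul_zero _
  | add m n _ _ hm hn => rw [smul_add, hm, hn, add_zero]

include P in
-- If `J` kills `m`, each component `e i m` spans a `K`-line stable under `Λ`, which is zero or a
-- simple submodule.
theorem Presentation.mem_socle_iff {m : M} :
    m ∈ socle Λ M ↔ ∀ a ∈ Ring.jacobson Λ, a • m = 0 := by
  refine ⟨fun hm a ha => smul_eq_zero_of_mem_socle hm ha, fun hm => ?_⟩
  rw [← P.sum_vertexElem_smul m]
  refine Submodule.sum_mem _ fun i _ => ?_
  have hline : ∀ r : Λ, ∃ c : K, r • P.toAlgHom (vertexElem K i) • m =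
      c • P.toAlgHom (vertexElem K i) • m := by
    intro r
    obtain ⟨c, hc⟩ := P.exists_smul_eq_sum (P.toAlgHom (vertexElem K i) • m)
      (fun a ha => by rw [smul_smul]; exact hm _ (Ideal.mul_mem_right _ _ ha)) r
    refine ⟨c i, ?_⟩
    rw [hc, Finset.sum_eq_single i]
    · rw [smul_smul (P.toAlgHom _), ← map_mul, vertexElem_mul_self]
    · intro j _ hj
      rw [smul_smul (P.toAlgHom _), ← map_mul, vertexElem_mul_of_ne hj, map_zero, zero_smul,
        smul_zero]
    · simp
  generalize P.toAlgHom (vertexElem K i) • m = v at hline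
  by_cases hv : v = 0
  · rw [hv]
    exact zero_mem _
  refine Submodule.mem_sSup_of_mem (s := Submodule.span Λ {v}) ?_ (Submodule.mem_span_singleton_self v)
  rw [Set.mem_ofPred_eq, isSimpleModule_iff_isAtom]
  refine ⟨by simpa using hv, fun N hN => ?_⟩
  by_contra hbot
  obtain ⟨w, hw, hw0⟩ := N.ne_bot_iff.1 hbot
  obtain ⟨r, rfl⟩ := Submodule.mem_span_singleton.1 (hN.le hw)
  obtain ⟨c, hc⟩ := hline r
  rw [hc] at hw hw0
  have hc0 : c ≠ 0 := fun h => hw0 (by rw [h, zero_smul])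
  refine hN.not_ge ((Submodule.span_singleton_le_iff_mem _ _).2 ?_)
  have := N.smul_of_tower_mem c⁻¹ hw
  rwa [smul_smul, inv_mul_cancel₀ hc0, one_smul] at this

end

end Modules

/-! ### Polynomial functions and irreducibility -/

section RegularFunction

variable {K : Type u} [Field K] {V : Type v} [Quiver.{w} V] {d : V → ℕ}

theorem isClosed_iff_exists_zeroLocus {Z : Set (RepSpace K d)} :
    IsClosed Z ↔ ∃ S : Set (MvPolynomial (Coord d) K), Z = zeroLocus S := by
  rw [← isOpen_compl_iff]
  change Zᶜᶜ ∈ {Z | ∃ S : Set (MvPolynomial (Coord d) K), Z = zeroLocus S} ↔ _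
  rw [compl_compl]
  rfl

theorem isClosed_zeroLocus (S : Set (MvPolynomial (Coord d) K)) : IsClosed (zeroLocus S) :=
  isClosed_iff_exists_zeroLocus.2 ⟨S, rfl⟩

/-- Functions on the space of tuples of matrices that are polynomial in the entries. -/
def IsRegular (f : RepSpace K d → K) : Prop :=
  ∃ p : MvPolynomial (Coord d) K, ∀ x, f x = MvPolynomial.eval x.coords p

theorem IsRegular.isOpen_ne_zero {f : RepSpace K d → K} (hf : IsRegular f) :
    IsOpen {x | f x ≠ 0} := by
  obtain ⟨p, hp⟩ := hf
  have h : {x | f x ≠ 0} = (zeroLocus {p})ᶜ := by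
    ext x
    simp [zeroLocus, hp]
  rw [h]
  exact (isClosed_zeroLocus _).isOpen_compl

theorem IsRegular.const (c : K) : IsRegular (fun _ : RepSpace K d => c) :=
  ⟨MvPolynomial.C c, fun _ => by simp⟩

theorem IsRegular.coord {i j : V} (a : i ⟶ j) (s : Fin (d j)) (t : Fin (d i)) :
    IsRegular (fun x : RepSpace K d => x a s t) :=
  ⟨MvPolynomial.X ⟨i, j, a, s, t⟩, fun _ => by simp [RepSpace.coords]⟩

theorem IsRegular.mul {f g : RepSpace K d → K} (hf : IsRegular f) (hg : IsRegular g) :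
    IsRegular (fun x => f x * g x) := by
  obtain ⟨p, hp⟩ := hf
  obtain ⟨q, hq⟩ := hg
  exact ⟨p * q, fun x => by simp [hp, hq]⟩

theorem IsRegular.sum {ι : Type*} (s : Finset ι) {f : ι → RepSpace K d → K}
    (hf : ∀ i, IsRegular (f i)) : IsRegular (fun x => ∑ i ∈ s, f i x) := by
  choose p hp using hf
  exact ⟨∑ i ∈ s, p i, fun x => by simp [hp]⟩

theorem IsRegular.prod {ι : Type*} (s : Finset ι) {f : ι → RepSpace K d → K}
    (hf : ∀ i, IsRegular (f i)) : IsRegular (fun x => ∏ i ∈ s, f i x) := by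
  choose p hp using hf
  exact ⟨∏ i ∈ s, p i, fun x => by simp [hp]⟩

theorem IsRegular.det {n : ℕ} {A : RepSpace K d → Matrix (Fin n) (Fin n) K}
    (hA : ∀ s t, IsRegular (fun x => A x s t)) : IsRegular (fun x => (A x).det) := by
  simp only [Matrix.det_apply', ← zsmul_eq_mul]
  simp only [zsmul_eq_mul]
  exact IsRegular.sum _ fun σ => (IsRegular.const _).mul (IsRegular.prod _ fun i => hA _ _)

theorem IsRegular.apply_mulVec {i j : V} (a : i ⟶ j) (v : Fin (d i) → K)
    (φ : (Fin (d j) → K) →ₗ[K] K) : IsRegular (fun x : RepSpace K d => φ ((x a).mulVec v)) := by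
  have h : ∀ x : RepSpace K d, φ ((x a).mulVec v) =
      ∑ s, (∑ t, x a s t * v t) * φ (Pi.single s 1) := by
    intro x
    rw [LinearMap.pi_apply_eq_sum_univ φ]
    simp only [Matrix.mulVec, dotProduct, smul_eq_mul]
    refine Finset.sum_congr rfl fun s _ => ?_
    congr 2
    ext t
    simp [Pi.single_apply, eq_comm]
  simp only [h]
  exact IsRegular.sum _ fun s => (IsRegular.sum _ fun t =>
    (IsRegular.coord a s t).mul (IsRegular.const _)).mul (IsRegular.const _)

/-- Lower semicontinuity of the rank of a linear map depending polynomially on a point. -/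
theorem isOpen_le_finrank_range {E F : Type*} [AddCommGroup E] [Module K E] [AddCommGroup F]
    [Module K F] [FiniteDimensional K F] (A : RepSpace K d → E →ₗ[K] F)
    (hA : ∀ (v : E) (φ : F →ₗ[K] K), IsRegular (fun x => φ (A x v))) (r : ℕ) :
    IsOpen {x | r ≤ Module.finrank K (LinearMap.range (A x))} := by
  rw [isOpen_iff_forall_mem_open]
  intro x₀ hx₀
  let b := Module.finBasis K (LinearMap.range (A x₀))
  choose v hv using fun k : Fin r => (b (Fin.castLE hx₀ k)).2
  have hli : LinearIndependent K (fun k => A x₀ (v k)) := by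
    have h := (b.linearIndependent.comp _ (Fin.castLE_injective hx₀)).map'
      (LinearMap.range (A x₀)).subtype (Submodule.ker_subtype _)
    simpa [Function.comp_def, hv] using h
  -- The left inverse `g` of the map sending basis vectors to `A x₀ (v k)` makes the matrix `B x₀`
  -- the identity. Wherever `det (B x)` stays nonzero, the `r` vectors `A x (v k)` remain
  -- independent.
  obtain ⟨g, hg⟩ := LinearMap.exists_leftInverse_of_injective _
    (LinearMap.ker_eq_bot.2 (linearIndependent_iff_injective_fintypeLinearCombination.1 hli))
  let B : RepSpace K d → Matrix (Fin r) (Fin r) K := fun x => Matrix.of fun s t => g (A x (v t)) s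
  refine ⟨{x | (B x).det ≠ 0}, fun x hx => ?_, ?_, ?_⟩
  · have h1 : LinearIndependent K (B x).col :=
      Matrix.linearIndependent_cols_iff_isUnit.2
        ((Matrix.isUnit_iff_isUnit_det _).2 (isUnit_iff_ne_zero.2 hx))
    have h2 : LinearIndependent K
        (fun k => (⟨A x (v k), v k, rfl⟩ : LinearMap.range (A x))) :=
      LinearIndependent.of_comp (g ∘ₗ (LinearMap.range (A x)).subtype) h1
    simpa using h2.fintype_card_le_finrank
  · exact (IsRegular.det fun s t => hA (v t) (LinearMap.proj s ∘ₗ g)).isOpen_ne_zero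
  · have h : B x₀ = 1 := by
      ext s t
      have := congrFun (LinearMap.congr_fun hg (Pi.single t 1)) s
      simpa [B, Fintype.linearCombination_apply_single, Matrix.one_apply, Pi.single_apply]
        using this
    simp [h]

/-- The point with parameter `s` on the line through `x` and `y`. -/
def RepSpace.line (x y : RepSpace K d) (s : K) : RepSpace K d :=
  fun _ _ a => x a + s • (y a - x a)

/-- Restricting to the line a polynomial that witnesses membership in `U` gives `q`: an open set met
by a line contains all but finitely many of its parameters. -/
theorem exists_polynomial_of_mem_isOpen {U : Set (RepSpace K d)} (hU : IsOpen U)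
    (x y : RepSpace K d) {s₀ : K} (h : x.line y s₀ ∈ U) :
    ∃ q : Polynomial K, q ≠ 0 ∧ ∀ s, q.eval s ≠ 0 → x.line y s ∈ U := by
  obtain ⟨S, hS⟩ := isClosed_iff_exists_zeroLocus.1 hU.isClosed_compl
  have hmem : ∀ z, z ∈ U ↔ ∃ f ∈ S, MvPolynomial.eval z.coords f ≠ 0 := by
    intro z
    rw [← not_iff_not, ← Set.mem_compl_iff, hS]
    simp [zeroLocus]
  obtain ⟨f, hf, hne⟩ := (hmem _).1 h
  let q : Polynomial K := MvPolynomial.aeval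
    (fun c => Polynomial.C (x.coords c) + Polynomial.X * Polynomial.C (y.coords c - x.coords c)) f
  have hq : ∀ s, q.eval s = MvPolynomial.eval (x.line y s).coords f := by
    intro s
    have : q.eval s = Polynomial.aeval s q := by simp
    rw [this, MvPolynomial.comp_aeval_apply, ← MvPolynomial.coe_aeval_eq_eval]
    change MvPolynomial.aeval _ f = MvPolynomial.aeval _ f
    congr 2
    ext c
    simp [RepSpace.coords, RepSpace.line]
  refine ⟨q, ?_, fun s hs => (hmem _).2 ⟨f, hf, hq s ▸ hs⟩⟩
  rintro h0
  rw [← hq, h0, Polynomial.eval_zero] at hne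
  exact hne rfl

/-- Join a point in each of the two open sets by a line. Each open set omits only finitely many
parameters, and `K` is infinite. -/
theorem isPreirreducible_of_line_mem [Infinite K] {A : Set (RepSpace K d)}
    (hA : ∀ x ∈ A, ∀ y ∈ A, ∀ s, x.line y s ∈ A) : IsPreirreducible A := by
  rintro U U' hU hU' ⟨x, hx, hxU⟩ ⟨y, hy, hyU⟩
  have h0 : x.line y 0 = x := by
    funext i j a
    simp [RepSpace.line]
  have h1 : x.line y 1 = y := by
    funext i j a
    simp [RepSpace.line]
  obtain ⟨q, hq, hqU⟩ := exists_polynomial_of_mem_isOpen hU x y (h0.symm ▸ hxU)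
  obtain ⟨q', hq', hqU'⟩ := exists_polynomial_of_mem_isOpen hU' x y (h1.symm ▸ hyU)
  obtain ⟨s, hs⟩ : ∃ s, (q * q').eval s ≠ 0 := by
    by_contra! h
    exact mul_ne_zero hq hq' (Polynomial.funext fun s => by simpa using h s)
  rw [Polynomial.eval_mul] at hs
  exact ⟨_, hA x hx y hy s, hqU s (left_ne_zero_of_mul hs), hqU' s (right_ne_zero_of_mul hs)⟩

end RegularFunction

/-! ### Radicals and socles of representations -/

section RadicalAndSocle

variable {K : Type u} [Field K] {V : Type v} [Quiver.{w} V] {d : V → ℕ}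

/-- The `j`-th component of the radical of the representation `x`. -/
def radSpace (x : RepSpace K d) (j : V) : Submodule K (Fin (d j) → K) :=
  ⨆ p : Σ i : V, (i ⟶ j), LinearMap.range (x p.2).mulVecLin

/-- The `i`-th component of the socle of the representation `x`. -/
def socSpace (x : RepSpace K d) (i : V) : Submodule K (Fin (d i) → K) :=
  ⨅ p : Σ j : V, (i ⟶ j), LinearMap.ker (x p.2).mulVecLin

theorem mulVec_mem_radSpace (x : RepSpace K d) {i j : V} (a : i ⟶ j) (v : Fin (d i) → K) :
    (x a).mulVec v ∈ radSpace x j :=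
  Submodule.mem_iSup_of_mem (p := fun p : Σ i : V, (i ⟶ j) => LinearMap.range (x p.2).mulVecLin)
    ⟨i, a⟩ ⟨v, rfl⟩

theorem radSpace_le_iff {x : RepSpace K d} {j : V} {B : Submodule K (Fin (d j) → K)} :
    radSpace x j ≤ B ↔ ∀ ⦃i : V⦄ (a : i ⟶ j) (v : Fin (d i) → K), (x a).mulVec v ∈ B := by
  refine ⟨fun h i a v => h (mulVec_mem_radSpace x a v), fun h => iSup_le ?_⟩
  rintro ⟨i, a⟩ _ ⟨v, rfl⟩
  exact h a v

theorem mem_socSpace {x : RepSpace K d} {i : V} {v : Fin (d i) → K} :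
    v ∈ socSpace x i ↔ ∀ ⦃j : V⦄ (a : i ⟶ j), (x a).mulVec v = 0 := by
  simp only [socSpace, Submodule.mem_iInf, LinearMap.mem_ker, Matrix.mulVecLin_apply, Sigma.forall]

variable [Fintype V] [∀ i j : V, Finite (i ⟶ j)]

-- The radical at `j` is the span of the columns of all matrices ending at `j`. Finitely supported
-- coefficients make this a range even for infinitely many arrows.
omit [Fintype V] [∀ i j : V, Finite (i ⟶ j)] in
theorem isOpen_le_finrank_radSpace (j : V) (r : ℕ) :
    IsOpen {x : RepSpace K d | r ≤ Module.finrank K (radSpace x j)} := by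
  classical
  let A : RepSpace K d → ((Σ p : Σ i : V, (i ⟶ j), Fin (d p.1)) →₀ K) →ₗ[K] (Fin (d j) → K) :=
    fun x => Finsupp.linearCombination K fun c => (x c.1.2).col c.2
  have hA : ∀ x, LinearMap.range (A x) = radSpace x j := by
    intro x
    rw [Finsupp.range_linearCombination]
    refine le_antisymm (Submodule.span_le.2 ?_) (iSup_le fun p => ?_)
    · rintro _ ⟨⟨⟨i, a⟩, t⟩, rfl⟩
      have := mulVec_mem_radSpace x a (Pi.single t 1)
      rwa [Matrix.mulVec_single_one] at this
    · rw [Matrix.range_mulVecLin]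
      refine Submodule.span_mono ?_
      rintro _ ⟨t, rfl⟩
      exact ⟨⟨p, t⟩, rfl⟩
  have h := isOpen_le_finrank_range A (fun v φ => ?_) r
  · exact (congrArg IsOpen (Set.ext fun x => by rw [Set.mem_ofPred_eq, Set.mem_ofPred_eq, hA])).mp h
  simp only [A, Finsupp.linearCombination_apply, Finsupp.sum, map_sum, map_smul, smul_eq_mul]
  refine IsRegular.sum _ fun c => (IsRegular.const _).mul ?_
  simpa only [Matrix.mulVec_single_one] using
    IsRegular.apply_mulVec c.1.2 (Pi.single c.2 1) φ

theorem isOpen_finrank_socSpace_le (i : V) (r : ℕ) :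
    IsOpen {x : RepSpace K d | Module.finrank K (socSpace x i) ≤ r} := by
  classical
  let A : RepSpace K d → (Fin (d i) → K) →ₗ[K] (∀ p : Σ j : V, (i ⟶ j), Fin (d p.1) → K) :=
    fun x => LinearMap.pi fun p => (x p.2).mulVecLin
  have hA : ∀ x, LinearMap.ker (A x) = socSpace x i := fun x => LinearMap.ker_pi _
  -- By rank-nullity. Truncated subtraction is harmless: for `r ≥ d i` both conditions are vacuous.
  have h : {x : RepSpace K d | Module.finrank K (socSpace x i) ≤ r} =
      {x | d i - r ≤ Module.finrank K (LinearMap.range (A x))} := by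
    ext x
    have := LinearMap.finrank_range_add_finrank_ker (A x)
    rw [hA, Module.finrank_fin_fun] at this
    simp only [Set.mem_ofPred_eq]
    omega
  rw [h]
  cases nonempty_fintype (Σ j : V, (i ⟶ j))
  refine isOpen_le_finrank_range A (fun v φ => ?_) _
  have hφ : ∀ x, φ (A x v) =
      ∑ p : Σ j : V, (i ⟶ j), (φ ∘ₗ LinearMap.single K _ p) ((x p.2).mulVec v) := by
    intro x
    conv_lhs => rw [← Finset.univ_sum_single (A x v), map_sum]
    rfl
  simp only [hφ]
  exact IsRegular.sum _ fun p => IsRegular.apply_mulVec p.2 v _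

end RadicalAndSocle

/-! ### The action on `M(x)`: relations, radical and socle at each vertex -/

section RepModule

variable {K : Type u} [Field K] {V : Type v} [Quiver.{w} V] [Fintype V] [DecidableEq V] {d : V → ℕ}

theorem pathAction_vertexElem (x : RepSpace K d) (i : V) (m : ∀ i : V, Fin (d i) → K) :
    pathAction x (vertexElem K i) m = Pi.single i (m i) := by
  rw [pathAction, vertexElem, RingQuot.liftAlgHom_mkAlgHom_apply, FreeAlgebra.lift_ι_apply]
  rfl

theorem pathAction_arrowElem (x : RepSpace K d) {i j : V} (a : i ⟶ j)
    (m : ∀ i : V, Fin (d i) → K) :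
    pathAction x (arrowElem K a) m = Pi.single j ((x a).mulVec (m i)) := by
  rw [pathAction, arrowElem, RingQuot.liftAlgHom_mkAlgHom_apply, FreeAlgebra.lift_ι_apply]
  rfl

/-- Only the last arrow of a path matters here; for the socle in the next lemma, only the first. -/
theorem pathAction_mem_radSpace (x : RepSpace K d) {r : PathAlgebra K V}
    (hr : r ∈ pathSpan K V 1) (m : ∀ i : V, Fin (d i) → K) (k : V) :
    pathAction x r m k ∈ radSpace x k := by
  induction hr using Submodule.span_induction with
  | mem r hr =>
    obtain ⟨i, j, p, hp, rfl⟩ := hr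
    cases p with
    | nil => simp at hp
    | cons p a =>
      rw [pathElem, map_mul, Module.End.mul_apply, pathAction_arrowElem]
      by_cases h : k = j
      · subst h
        rw [Pi.single_eq_same]
        exact mulVec_mem_radSpace x a _
      · rw [Pi.single_eq_of_ne h]
        exact zero_mem _
  | zero => simp
  | add r s _ _ hr hs =>
    rw [map_add, LinearMap.add_apply, Pi.add_apply]
    exact add_mem hr hs
  | smul c r _ hr =>
    rw [map_smul, LinearMap.smul_apply, Pi.smul_apply]
    exact Submodule.smul_mem _ c hr

theorem pathAction_eq_zero_of_mem_socSpace (x : RepSpace K d) {r : PathAlgebra K V}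
    (hr : r ∈ pathSpan K V 1) {m : ∀ i : V, Fin (d i) → K} (hm : ∀ i, m i ∈ socSpace x i) :
    pathAction x r m = 0 := by
  induction hr using Submodule.span_induction with
  | mem r hr =>
    obtain ⟨i, j, p, hp, rfl⟩ := hr
    induction p with
    | nil => simp at hp
    | cons p a ih =>
      rw [pathElem, map_mul, Module.End.mul_apply]
      rcases Nat.eq_zero_or_pos p.length with h | h
      · cases p with
        | nil =>
          rw [pathElem, pathAction_vertexElem, pathAction_arrowElem, Pi.single_eq_same,
            mem_socSpace.1 (hm _) a, Pi.single_zero]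
        | cons p b => simp at h
      · rw [ih h, map_zero]
  | zero => simp
  | add r s _ _ hr hs => rw [map_add, LinearMap.add_apply, hr, hs, add_zero]
  | smul c r _ hr => rw [map_smul, LinearMap.smul_apply, hr, smul_zero]

variable {Λ : Type z} [Ring Λ] [Algebra K Λ] (P : Presentation K V Λ)

/-- Admissibility puts every relation into the ideal generated by paths of length two. Such a path
first maps into the radical, hence into the socle, which the second arrow kills. -/
theorem Presentation.pathAction_eq_zero_of_radSpace_le {x : RepSpace K d}
    (hx : ∀ i, radSpace x i ≤ socSpace x i) {r : PathAlgebra K V} (hr : P.toAlgHom r = 0) :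
    pathAction x r = 0 := by
  have h : pathIdeal K V 2 ≤ TwoSidedIdeal.ker (pathAction x) := by
    refine TwoSidedIdeal.span_le.2 ?_
    rintro _ ⟨i, j, p, hp, rfl⟩
    rw [SetLike.mem_coe, TwoSidedIdeal.mem_ker]
    cases p with
    | nil => simp at hp
    | cons p a =>
      have hp' : 1 ≤ p.length := by simpa using hp.ge
      refine LinearMap.ext fun m => ?_
      rw [pathElem, map_mul, Module.End.mul_apply, pathAction_arrowElem,
        mem_socSpace.1 (hx _ (pathAction_mem_radSpace x (pathElem_mem_pathSpan p hp') m _)) a,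
        Pi.single_zero, LinearMap.zero_apply]
  have := h (P.admissible.1 ((TwoSidedIdeal.mem_ker _).2 hr))
  simpa [TwoSidedIdeal.mem_ker] using this

/-- The converse: since `J ^ 2 = 0`, every product of two arrows is itself a relation. -/
theorem RepVariety.radSpace_le_socSpace
    (hJ : ∀ a ∈ Ring.jacobson Λ, ∀ b ∈ Ring.jacobson Λ, a * b = 0) (x : RepVariety P d) (i : V) :
    radSpace x.1 i ≤ socSpace x.1 i := by
  refine radSpace_le_iff.2 fun h a v => mem_socSpace.2 fun j b => ?_
  have hab := x.2 (arrowElem K b * arrowElem K a) (by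
    rw [map_mul]
    exact hJ _ (P.map_arrowElem_mem_jacobson b) _ (P.map_arrowElem_mem_jacobson a))
  have := congrFun (LinearMap.congr_fun hab (Pi.single h v)) j
  rw [map_mul, Module.End.mul_apply, pathAction_arrowElem, pathAction_arrowElem, Pi.single_eq_same,
    Pi.single_eq_same, Pi.single_eq_same] at this
  exact this

instance (x : RepVariety P d) : Module.Finite K (RepModule P x) :=
  inferInstanceAs (Module.Finite K (∀ i : V, Fin (d i) → K))

theorem map_smul_repModule (x : RepVariety P d) (r : PathAlgebra K V) (m : RepModule P x) :
    P.toAlgHom r • m = pathAction x.1 r m := by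
  rw [repModule_smul_def, algAction_apply]

/-- The inclusion of the component at the vertex `i` into `M(x)`. -/
def repSingle (x : RepVariety P d) (i : V) : (Fin (d i) → K) →ₗ[K] RepModule P x :=
  LinearMap.single K (fun i => Fin (d i) → K) i

theorem repSingle_same (x : RepVariety P d) (i : V) (v : Fin (d i) → K) :
    repSingle P x i v i = v :=
  Pi.single_eq_same (M := fun i => Fin (d i) → K) i v

theorem repSingle_of_ne (x : RepVariety P d) {i j : V} (h : j ≠ i) (v : Fin (d i) → K) :
    repSingle P x i v j = 0 :=
  Pi.single_eq_of_ne (M := fun i => Fin (d i) → K) h v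

theorem repSingle_injective (x : RepVariety P d) (i : V) : Function.Injective (repSingle P x i) :=
  Pi.single_injective (M := fun i => Fin (d i) → K) i

theorem repSingle_apply_mem (x : RepVariety P d) {i : V} {v : Fin (d i) → K}
    {S : ∀ j : V, Submodule K (Fin (d j) → K)} (j : V) (hv : v ∈ S i) :
    repSingle P x i v j ∈ S j := by
  by_cases h : j = i
  · subst h
    rwa [repSingle_same]
  · rw [repSingle_of_ne P x h]
    exact zero_mem _

theorem sum_repSingle (x : RepVariety P d) (m : RepModule P x) :
    ∑ i, repSingle P x i (m i) = m :=
  Finset.univ_sum_single (M := fun i => Fin (d i) → K) m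

theorem vertexElem_smul_repModule (x : RepVariety P d) (i : V) (m : RepModule P x) :
    P.toAlgHom (vertexElem K i) • m = repSingle P x i (m i) :=
  (map_smul_repModule P x _ m).trans (pathAction_vertexElem x.1 i m)

theorem arrowElem_smul_repModule (x : RepVariety P d) {i j : V} (a : i ⟶ j) (m : RepModule P x) :
    P.toAlgHom (arrowElem K a) • m = repSingle P x j ((x.1 a).mulVec (m i)) :=
  (map_smul_repModule P x _ m).trans (pathAction_arrowElem x.1 a m)

theorem mem_jacobson_smul_top_iff (x : RepVariety P d) {m : RepModule P x} :
    m ∈ Ring.jacobson Λ • (⊤ : Submodule Λ (RepModule P x)) ↔ ∀ j, m j ∈ radSpace x.1 j := by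
  constructor
  · intro hm j
    induction hm using Submodule.smul_induction_on' with
    | smul a ha m _ =>
      obtain ⟨s, hs, rfl⟩ := P.exists_mem_pathSpan_of_mem_jacobson ha
      rw [map_smul_repModule]
      exact pathAction_mem_radSpace x.1 hs m j
    | add m _ n _ hm hn => exact add_mem hm hn
  · intro hm
    have h : ∀ j, radSpace x.1 j ≤
        ((Ring.jacobson Λ • (⊤ : Submodule Λ (RepModule P x))).restrictScalars K).comap
          (repSingle P x j) := by
      intro j
      refine radSpace_le_iff.2 fun i a v => ?_
      have := arrowElem_smul_repModule P x a (repSingle P x i v)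
      rw [repSingle_same] at this
      have hmem : repSingle P x j ((x.1 a).mulVec v) ∈
          Ring.jacobson Λ • (⊤ : Submodule Λ (RepModule P x)) :=
        this ▸ Submodule.smul_mem_smul (P.map_arrowElem_mem_jacobson a) Submodule.mem_top
      exact hmem
    rw [← sum_repSingle P x m]
    exact Submodule.sum_mem _ fun j _ => h j (hm j)

theorem mem_socle_repModule_iff (x : RepVariety P d) {m : RepModule P x} :
    m ∈ socle Λ (RepModule P x) ↔ ∀ i, m i ∈ socSpace x.1 i := by
  rw [P.mem_socle_iff]
  constructor
  · refine fun hm i => mem_socSpace.2 fun j a => ?_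
    have h := hm _ (P.map_arrowElem_mem_jacobson a)
    rw [arrowElem_smul_repModule] at h
    exact repSingle_injective P x j (h.trans (map_zero _).symm)
  · intro hm a ha
    obtain ⟨s, hs, rfl⟩ := P.exists_mem_pathSpan_of_mem_jacobson ha
    rw [map_smul_repModule]
    exact pathAction_eq_zero_of_mem_socSpace x.1 hs hm

theorem range_vertexElem_lsmul_repModule (x : RepVariety P d) (i : V) :
    LinearMap.range (Algebra.lsmul K K (RepModule P x) (P.toAlgHom (vertexElem K i))) =
      LinearMap.range (repSingle P x i) := by
  ext m
  constructor
  · rintro ⟨m, rfl⟩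
    exact ⟨m i, (vertexElem_smul_repModule P x i m).symm⟩
  · rintro ⟨v, rfl⟩
    refine ⟨repSingle P x i v, (vertexElem_smul_repModule P x i _).trans ?_⟩
    rw [repSingle_same]

theorem dimVec_repModule (x : RepVariety P d) : dimVec P (RepModule P x) = d := by
  funext i
  rw [dimVec, range_vertexElem_lsmul_repModule,
    LinearMap.finrank_range_of_inj (repSingle_injective P x i), Module.finrank_fin_fun]

/-- The component of the top at `j` is the quotient of `K ^ (d j)` by `radSpace x.1 j`. -/
theorem dimVec_top_add_finrank_radSpace (x : RepVariety P d) (j : V) :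
    dimVec P (top Λ (RepModule P x)) j + Module.finrank K (radSpace x.1 j) = d j := by
  let f : (Fin (d j) → K) →ₗ[K] top Λ (RepModule P x) :=
    (Submodule.mkQ _).restrictScalars K ∘ₗ repSingle P x j
  have hker : LinearMap.ker f = radSpace x.1 j := by
    ext v
    rw [LinearMap.mem_ker]
    change Submodule.Quotient.mk (repSingle P x j v) = 0 ↔ _
    rw [Submodule.Quotient.mk_eq_zero, mem_jacobson_smul_top_iff]
    exact ⟨fun h => by simpa only [repSingle_same] using h j,
      fun h i => repSingle_apply_mem P x i h⟩
  have hrange : LinearMap.range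
      (Algebra.lsmul K K (top Λ (RepModule P x)) (P.toAlgHom (vertexElem K j))) =
      LinearMap.range f := by
    ext m
    constructor
    · rintro ⟨m, rfl⟩
      obtain ⟨m, rfl⟩ := Submodule.Quotient.mk_surjective _ m
      exact ⟨m j, congrArg Submodule.Quotient.mk (vertexElem_smul_repModule P x j m).symm⟩
    · rintro ⟨v, rfl⟩
      refine ⟨f v, congrArg Submodule.Quotient.mk
        ((vertexElem_smul_repModule P x j (repSingle P x j v)).trans ?_)⟩
      rw [repSingle_same]
  have h := LinearMap.finrank_range_add_finrank_ker f
  rwa [hker, ← hrange, Module.finrank_fin_fun] at h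

theorem dimVec_socle_repModule (x : RepVariety P d) (i : V) :
    dimVec P (socle Λ (RepModule P x)) i = Module.finrank K (socSpace x.1 i) := by
  have hs : ∀ v ∈ socSpace x.1 i,
      repSingle P x i v ∈ (socle Λ (RepModule P x)).restrictScalars K := fun v hv =>
    (mem_socle_repModule_iff P x).2 fun j => repSingle_apply_mem P x j hv
  let f : socSpace x.1 i →ₗ[K] socle Λ (RepModule P x) := (repSingle P x i).restrict hs
  have hf : Function.Injective f := fun v w h =>
    Subtype.ext (repSingle_injective P x i (congrArg Subtype.val h))
  have hrange : LinearMap.range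
      (Algebra.lsmul K K (socle Λ (RepModule P x)) (P.toAlgHom (vertexElem K i))) =
      LinearMap.range f := by
    ext m
    constructor
    · rintro ⟨m, rfl⟩
      exact ⟨⟨m.1 i, (mem_socle_repModule_iff P x).1 m.2 i⟩,
        Subtype.ext (vertexElem_smul_repModule P x i m.1).symm⟩
    · rintro ⟨v, rfl⟩
      refine ⟨f v, Subtype.ext
        ((vertexElem_smul_repModule P x i (repSingle P x i v.1)).trans ?_)⟩
      rw [repSingle_same]
      rfl
  rw [dimVec, hrange, LinearMap.finrank_range_of_inj hf]

end RepModule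

/-! ### Strata, generic socles and closures -/

section LinearAlgebra

variable {K : Type*} [Field K] {E : Type*} [AddCommGroup E] [Module K E] [FiniteDimensional K E]

theorem exists_submodule_between_finrank_eq {A C : Submodule K E} (hAC : A ≤ C) {n : ℕ}
    (hA : Module.finrank K A ≤ n) (hC : n ≤ Module.finrank K C) :
    ∃ B : Submodule K E, A ≤ B ∧ B ≤ C ∧ Module.finrank K B = n := by
  induction n, hA using Nat.le_induction with
  | base => exact ⟨A, le_rfl, hAC, rfl⟩
  | succ n _ ih =>
    obtain ⟨B, hAB, hBC, hB⟩ := ih (by omega)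
    obtain ⟨v, hv, hvB⟩ : ∃ v ∈ C, v ∉ B := by
      by_contra! h
      have := Submodule.finrank_mono (show C ≤ B from h)
      omega
    refine ⟨B ⊔ K ∙ v, hAB.trans le_sup_left,
      sup_le hBC ((Submodule.span_singleton_le_iff_mem _ _).2 hv), le_antisymm ?_ ?_⟩
    · have h1 := Submodule.finrank_add_le_finrank_add_finrank B (K ∙ v)
      have h2 := finrank_span_le_card (R := K) ({v} : Set E)
      simp only [Set.toFinset_singleton, Finset.card_singleton] at h2
      omega
    · rw [← hB]
      refine Submodule.finrank_lt_finrank_of_lt (lt_of_le_of_ne le_sup_left fun h => hvB ?_)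
      rw [h]
      exact Submodule.mem_sup_right (Submodule.mem_span_singleton_self v)

theorem exists_linearEquiv_map_eq {B B' : Submodule K E}
    (h : Module.finrank K B = Module.finrank K B') :
    ∃ g : E ≃ₗ[K] E, B.map g.toLinearMap = B' := by
  obtain ⟨C, hC⟩ := B.exists_isCompl
  obtain ⟨C', hC'⟩ := B'.exists_isCompl
  have h1 := Submodule.finrank_add_eq_of_isCompl hC
  have h2 := Submodule.finrank_add_eq_of_isCompl hC'
  let g : E ≃ₗ[K] E := (Submodule.prodEquivOfIsCompl B C hC).symm ≪≫ₗ
    ((LinearEquiv.ofFinrankEq B B' h).prodCongr (LinearEquiv.ofFinrankEq C C' (by omega))) ≪≫ₗ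
    Submodule.prodEquivOfIsCompl B' C' hC'
  refine ⟨g, Submodule.eq_of_le_of_finrank_eq ?_ ?_⟩
  · rintro _ ⟨v, hv, rfl⟩
    have : (Submodule.prodEquivOfIsCompl B C hC).symm v = (⟨v, hv⟩, 0) :=
      Submodule.prodEquivOfIsCompl_symm_apply_left B C hC ⟨v, hv⟩
    simp [g, this]
  · rw [← h]
    exact LinearEquiv.finrank_map_eq g B

end LinearAlgebra

/-! ### Layers: irreducibility and base change -/

section Layer

variable {K : Type u} [Field K] {V : Type v} [Quiver.{w} V] {d : V → ℕ}

/-- The tuples whose radical is contained in `B` and whose socle contains `B`. -/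
def layer (B : ∀ i : V, Submodule K (Fin (d i) → K)) : Set (RepSpace K d) :=
  {x | ∀ i, radSpace x i ≤ B i ∧ B i ≤ socSpace x i}

/-- Mapping into `B` and vanishing on `B` are linear conditions on the matrices, so a layer contains
the line through any two of its points. -/
theorem isPreirreducible_layer [Infinite K] (B : ∀ i : V, Submodule K (Fin (d i) → K)) :
    IsPreirreducible (layer B) := by
  refine isPreirreducible_of_line_mem fun x hx y hy s i => ⟨?_, ?_⟩
  · refine radSpace_le_iff.2 fun h a v => ?_
    have hx' := radSpace_le_iff.1 (hx i).1 a v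
    have hy' := radSpace_le_iff.1 (hy i).1 a v
    rw [RepSpace.line, Matrix.add_mulVec, Matrix.smul_mulVec, Matrix.sub_mulVec]
    exact add_mem hx' (Submodule.smul_mem _ _ (sub_mem hy' hx'))
  · refine fun v hv => mem_socSpace.2 fun j a => ?_
    rw [RepSpace.line, Matrix.add_mulVec, Matrix.smul_mulVec, Matrix.sub_mulVec,
      mem_socSpace.1 ((hx i).2 hv), mem_socSpace.1 ((hy i).2 hv), sub_zero, smul_zero, add_zero]

theorem IsPreirreducible.inter_iInter_nonempty {X ι : Type*} [TopologicalSpace X] [Finite ι]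
    {A : Set X} (hA : IsPreirreducible A) (hne : A.Nonempty) {U : ι → Set X}
    (hU : ∀ i, IsOpen (U i)) (h : ∀ i, (A ∩ U i).Nonempty) : (A ∩ ⋂ i, U i).Nonempty := by
  have := isIrreducible_iff_sInter.1 ⟨hne, hA⟩ (Set.finite_range U).toFinset
    (by simpa using hU) (by simpa using h)
  simpa [Set.sInter_range] using this

/-- The base change of a tuple of matrices. -/
def baseChange (g : ∀ i : V, (Fin (d i) → K) ≃ₗ[K] (Fin (d i) → K)) (x : RepSpace K d) :
    RepSpace K d :=
  fun i j a => LinearMap.toMatrix' ((g j).toLinearMap ∘ₗ (x a).mulVecLin ∘ₗ (g i).symm.toLinearMap)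

theorem baseChange_mulVec (g : ∀ i : V, (Fin (d i) → K) ≃ₗ[K] (Fin (d i) → K)) (x : RepSpace K d)
    {i j : V} (a : i ⟶ j) (v : Fin (d i) → K) :
    (baseChange g x a).mulVec v = g j ((x a).mulVec ((g i).symm v)) := by
  rw [baseChange, LinearMap.toMatrix'_mulVec]
  rfl

theorem radSpace_baseChange (g : ∀ i : V, (Fin (d i) → K) ≃ₗ[K] (Fin (d i) → K))
    (x : RepSpace K d) (j : V) :
    radSpace (baseChange g x) j = (radSpace x j).map (g j).toLinearMap := by
  refine le_antisymm (radSpace_le_iff.2 fun i a v => ?_) (Submodule.map_le_iff_le_comap.2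
    (radSpace_le_iff.2 fun i a v => ?_))
  · rw [baseChange_mulVec]
    exact ⟨_, mulVec_mem_radSpace x a _, rfl⟩
  · have h := mulVec_mem_radSpace (baseChange g x) a (g i v)
    rwa [baseChange_mulVec, LinearEquiv.symm_apply_apply] at h

theorem socSpace_baseChange (g : ∀ i : V, (Fin (d i) → K) ≃ₗ[K] (Fin (d i) → K))
    (x : RepSpace K d) (i : V) :
    socSpace (baseChange g x) i = (socSpace x i).map (g i).toLinearMap := by
  ext v
  rw [Submodule.mem_map_equiv, mem_socSpace, mem_socSpace]
  simp only [baseChange_mulVec, map_eq_zero_iff _ (g _).injective]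

/-- Base change by automorphisms taking `radSpace y i` to `B i` transports radical and socle
together, so `B` becomes the radical and stays inside the socle. -/
theorem exists_mem_layer {y : RepSpace K d} (hy : ∀ i, radSpace y i ≤ socSpace y i)
    {B : ∀ i : V, Submodule K (Fin (d i) → K)}
    (hB : ∀ i, Module.finrank K (radSpace y i) = Module.finrank K (B i)) :
    ∃ z ∈ layer B, (∀ i, radSpace z i = B i) ∧
      ∀ i, Module.finrank K (socSpace z i) = Module.finrank K (socSpace y i) := by
  choose g hg using fun i => exists_linearEquiv_map_eq (hB i)
  have hrad : ∀ i, radSpace (baseChange g y) i = B i := fun i =>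
    (radSpace_baseChange g y i).trans (hg i)
  refine ⟨baseChange g y, fun i => ⟨(hrad i).le, ?_⟩, hrad, fun i => ?_⟩
  · rw [socSpace_baseChange, ← hg i]
    exact Submodule.map_mono (hy i)
  · rw [socSpace_baseChange]
    exact LinearEquiv.finrank_map_eq (g i) _

theorem radSpace_eq_of_mem_layer {B : ∀ i : V, Submodule K (Fin (d i) → K)} {z : RepSpace K d}
    (hz : z ∈ layer B) {i : V} (h : Module.finrank K (B i) ≤ Module.finrank K (radSpace z i)) :
    radSpace z i = B i :=
  Submodule.eq_of_le_of_finrank_le (hz i).1 h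

theorem radSpace_le_socSpace_of_mem_layer {B : ∀ i : V, Submodule K (Fin (d i) → K)}
    {z : RepSpace K d} (hz : z ∈ layer B) (i : V) : radSpace z i ≤ socSpace z i :=
  (hz i).1.trans (hz i).2

end Layer

/-! ### Strata, their generic socles and their closures -/

section Stratum

variable {K : Type u} [Field K] {V : Type v} [Quiver.{w} V] [Fintype V] [DecidableEq V] {d : V → ℕ}
variable {Λ : Type z} [Ring Λ] [Algebra K Λ] (P : Presentation K V Λ)

theorem smul_top_eq_zero {A M : Type*} [Ring A] [AddCommGroup M] [Module A M] {a : A}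
    (ha : a ∈ Ring.jacobson A) (m : top A M) : a • m = 0 := by
  obtain ⟨m, rfl⟩ := Submodule.Quotient.mk_surjective _ m
  rw [← Submodule.Quotient.mk_smul, Submodule.Quotient.mk_eq_zero]
  exact Submodule.smul_mem_smul ha Submodule.mem_top

theorem finite_top (M : Type*) [AddCommGroup M] [Module K M] [Module Λ M] [IsScalarTower K Λ M]
    [Module.Finite K M] : Module.Finite K (top Λ M) := by
  let f : M →ₗ[K] top Λ M := (Submodule.mkQ _).restrictScalars K
  have hf : Function.Surjective f := Submodule.Quotient.mk_surjective _
  exact Module.Finite.of_surjective f hf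

theorem finite_socle (M : Type*) [AddCommGroup M] [Module K M] [Module Λ M] [IsScalarTower K Λ M]
    [Module.Finite K M] : Module.Finite K (socle Λ M) :=
  Module.Finite.of_injective ((socle Λ M).subtype.restrictScalars K) Subtype.val_injective

instance (x : RepVariety P d) : Module.Finite K (top Λ (RepModule P x)) :=
  finite_top _

instance (x : RepVariety P d) : Module.Finite K (socle Λ (RepModule P x)) :=
  finite_socle _

/-- Tops are killed by `J`, so they are determined by their dimension vectors, which are
complementary to the radical dimensions. -/
theorem mem_stratum_iff {T : Type*} [AddCommGroup T] [Module Λ T] {y : RepVariety P d}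
    (hy : y ∈ stratum P d T) (x : RepVariety P d) :
    x ∈ stratum P d T ↔
      ∀ j, Module.finrank K (radSpace x.1 j) = Module.finrank K (radSpace y.1 j) := by
  obtain ⟨e⟩ := hy
  constructor
  · rintro ⟨f⟩ j
    have h := congrFun (dimVec_congr P (f ≪≫ₗ e.symm)) j
    have hx := dimVec_top_add_finrank_radSpace P x j
    have hy := dimVec_top_add_finrank_radSpace P y j
    omega
  · intro h
    obtain ⟨f⟩ := P.nonempty_linearEquiv_of_dimVec_eq (M := top Λ (RepModule P x))
      (N := top Λ (RepModule P y)) (fun a ha m => smul_top_eq_zero ha m)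
      (fun a ha m => smul_top_eq_zero ha m) (funext fun j => by
        have hj := h j
        have hx := dimVec_top_add_finrank_radSpace P x j
        have hy := dimVec_top_add_finrank_radSpace P y j
        omega)
    exact ⟨f ≪≫ₗ e⟩

theorem nonempty_socle_linearEquiv {x y : RepVariety P d}
    (h : ∀ i, Module.finrank K (socSpace x.1 i) = Module.finrank K (socSpace y.1 i)) :
    Nonempty (socle Λ (RepModule P x) ≃ₗ[Λ] socle Λ (RepModule P y)) :=
  P.nonempty_linearEquiv_of_dimVec_eq
    (fun _ ha m => Subtype.ext (smul_eq_zero_of_mem_socle m.2 ha))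
    (fun _ ha m => Subtype.ext (smul_eq_zero_of_mem_socle m.2 ha))
    (funext fun i => by rw [dimVec_socle_repModule, dimVec_socle_repModule, h i])

/-- The point of the representation variety given by a tuple in a layer. -/
def RepVariety.ofLayer {B : ∀ i : V, Submodule K (Fin (d i) → K)} {z : RepSpace K d}
    (hz : z ∈ layer B) : RepVariety P d :=
  ⟨z, fun _ hr => P.pathAction_eq_zero_of_radSpace_le (radSpace_le_socSpace_of_mem_layer hz) hr⟩

theorem isOpen_le_finrank_radSpace_repVariety (j : V) (r : ℕ) :
    IsOpen {x : RepVariety P d | r ≤ Module.finrank K (radSpace x.1 j)} :=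
  (isOpen_le_finrank_radSpace j r).preimage continuous_subtype_val

/-- A layer whose dimensions are those of the radicals of the modules in a stratum contains a
dense subset of points of that stratum. -/
theorem exists_mem_stratum_of_mem_layer [Infinite K] {T : Type*} [AddCommGroup T] [Module Λ T]
    {y : RepVariety P d} (hy : y ∈ stratum P d T)
    (hJ : ∀ a ∈ Ring.jacobson Λ, ∀ b ∈ Ring.jacobson Λ, a * b = 0)
    {B : ∀ i : V, Submodule K (Fin (d i) → K)}
    (hB : ∀ i, Module.finrank K (radSpace y.1 i) = Module.finrank K (B i))
    {U : Set (RepSpace K d)} (hU : IsOpen U) (hBU : (layer B ∩ U).Nonempty) :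
    ∃ z ∈ stratum P d T, z.1 ∈ layer B ∩ U := by
  obtain ⟨y', hy'B, hy', -⟩ := exists_mem_layer (RepVariety.radSpace_le_socSpace P hJ y) hB
  -- Maximal radical rank is an open condition on the layer, met by the conjugate `y'` of `y`.
  -- Irreducibility yields a point of `U` satisfying it, and there the radical fills `B`.
  obtain ⟨z, hzB, hzU, hz⟩ := isPreirreducible_layer B U
    (⋂ j, {x | Module.finrank K (B j) ≤ Module.finrank K (radSpace x j)}) hU
    (isOpen_iInter_of_finite fun j => isOpen_le_finrank_radSpace j _) hBU
    ⟨y', hy'B, Set.mem_iInter.2 fun j => by rw [Set.mem_ofPred_eq, hy' j]⟩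
  refine ⟨RepVariety.ofLayer P hzB, (mem_stratum_iff P hy _).2 fun j => ?_, hzB, hzU⟩
  rw [hB j]
  exact congrArg (fun S : Submodule K _ => Module.finrank K S)
    (radSpace_eq_of_mem_layer hzB (Set.mem_iInter.1 hz j))

theorem exists_dense_minimal_socSpace [Infinite K] [∀ i j : V, Finite (i ⟶ j)]
    {T : Type*} [AddCommGroup T] [Module Λ T]
    (hJ : ∀ a ∈ Ring.jacobson Λ, ∀ b ∈ Ring.jacobson Λ, a * b = 0)
    (hT : (stratum P d T).Nonempty) :
    ∃ s : V → ℕ, (∀ x ∈ stratum P d T, ∀ i, s i ≤ Module.finrank K (socSpace x.1 i)) ∧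
      stratum P d T ⊆ closure (stratum P d T ∩
        {x | ∀ i, Module.finrank K (socSpace x.1 i) ≤ s i}) := by
  -- A priori the minima at different vertices are attained at different points `y i`.
  choose y hy hmin using fun i => exists_minimalFor_of_wellFoundedLT (· ∈ stratum P d T)
    (fun x => Module.finrank K (socSpace x.1 i)) hT
  refine ⟨fun i => Module.finrank K (socSpace (y i).1 i), fun x hx i => ?_, fun x hx => ?_⟩
  · rcases le_total (Module.finrank K (socSpace (y i).1 i)) (Module.finrank K (socSpace x.1 i))
      with h | h
    · exact h
    · exact hmin i hx h
  refine mem_closure_iff.2 fun W hW hxW => ?_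
  obtain ⟨U, hU, rfl⟩ := isOpen_induced_iff.1 hW
  have hx' : x.1 ∈ layer (radSpace x.1) := fun i =>
    ⟨le_rfl, RepVariety.radSpace_le_socSpace P hJ x i⟩
  have hopen := fun i => isOpen_finrank_socSpace_le (K := K) (d := d) i
    (Module.finrank K (socSpace (y i).1 i))
  -- Every `y i` has a conjugate in the layer of `radSpace x.1` with the same socle dimensions, so
  -- irreducibility of this one layer realizes all minima simultaneously.
  obtain ⟨w, hwB, hw⟩ := IsPreirreducible.inter_iInter_nonempty
    (isPreirreducible_layer (radSpace x.1)) ⟨x.1, hx'⟩ hopen fun i => by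
      obtain ⟨z, hzB, -, hz⟩ := exists_mem_layer
        (RepVariety.radSpace_le_socSpace P hJ (y i)) ((mem_stratum_iff P hx (y i)).1 (hy i))
      exact ⟨z, hzB, (hz i).le⟩
  -- Irreducibility again brings such a point into the neighbourhood `U` of `x`; density of the
  -- stratum in the layer then replaces it by a point of the stratum.
  obtain ⟨z, hzB, hzU, hz⟩ := isPreirreducible_layer (radSpace x.1) U _ hU
    (isOpen_iInter_of_finite hopen) ⟨x.1, hx', hxW⟩ ⟨w, hwB, hw⟩
  obtain ⟨v, hv, -, hvU, hvS⟩ := exists_mem_stratum_of_mem_layer P hx hJ (fun _ => rfl)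
    (hU.inter (isOpen_iInter_of_finite hopen)) ⟨z, hzB, hzU, hz⟩
  exact ⟨v, hvU, hv, Set.mem_iInter.1 hvS⟩

theorem isOpen_finrank_socSpace_le_repVariety [∀ i j : V, Finite (i ⟶ j)] (s : V → ℕ) :
    IsOpen {x : RepVariety P d | ∀ i, Module.finrank K (socSpace x.1 i) ≤ s i} := by
  rw [Set.ofPred_forall]
  exact isOpen_iInter_of_finite fun i =>
    (isOpen_finrank_socSpace_le i (s i)).preimage continuous_subtype_val

theorem exists_isGenericSocle [Infinite K] [∀ i j : V, Finite (i ⟶ j)]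
    {T : Type*} [AddCommGroup T] [Module Λ T]
    (hJ : ∀ a ∈ Ring.jacobson Λ, ∀ b ∈ Ring.jacobson Λ, a * b = 0)
    (hT : (stratum P d T).Nonempty) :
    ∃ x ∈ stratum P d T, IsGenericSocle P (stratum P d T) (socle Λ (RepModule P x)) := by
  obtain ⟨s, hs, hdense⟩ := exists_dense_minimal_socSpace P hJ hT
  obtain ⟨x, hxT, hx⟩ := closure_nonempty_iff.1 (hT.mono hdense)
  refine ⟨x, hxT, _, ⟨_, isOpen_finrank_socSpace_le_repVariety P s, rfl⟩, hdense, ?_⟩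
  rintro z ⟨hzT, hz⟩
  exact nonempty_socle_linearEquiv P fun i =>
    ((hz i).antisymm (hs z hzT i)).trans ((hx i).antisymm (hs x hxT i)).symm

theorem finrank_radSpace_le_of_mem_closure {T : Type*} [AddCommGroup T] [Module Λ T]
    {x y : RepVariety P d} (hy : y ∈ stratum P d T) (hx : x ∈ closure (stratum P d T)) (j : V) :
    Module.finrank K (radSpace x.1 j) ≤ Module.finrank K (radSpace y.1 j) := by
  by_contra! h
  obtain ⟨z, hz, hzT⟩ := mem_closure_iff.1 hx _ (isOpen_le_finrank_radSpace_repVariety P j _) h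
  rw [Set.mem_ofPred_eq, (mem_stratum_iff P hy z).1 hzT j] at hz
  omega

theorem le_finrank_socSpace_of_mem_closure [∀ i j : V, Finite (i ⟶ j)] {O : Set (RepVariety P d)}
    {i : V} {s : ℕ} (hO : ∀ x ∈ O, s ≤ Module.finrank K (socSpace x.1 i))
    {x : RepVariety P d} (hx : x ∈ closure O) : s ≤ Module.finrank K (socSpace x.1 i) := by
  by_contra! h
  obtain ⟨z, hz, hzO⟩ := mem_closure_iff.1 hx
    {z : RepVariety P d | Module.finrank K (socSpace z.1 i) ≤ Module.finrank K (socSpace x.1 i)}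
    ((isOpen_finrank_socSpace_le i _).preimage continuous_subtype_val) (le_refl (Module.finrank K _))
  exact absurd ((hO z hzO).trans hz) (not_le.2 h)

/-- The inequalities leave room for a `B` between the radical and the socle of `x` with the radical
dimensions of `y`. Then `x` lies in `layer B`, every nonempty open part of which meets the stratum
of `y`. -/
theorem mem_closure_stratum [Infinite K] {T : Type*} [AddCommGroup T] [Module Λ T]
    (hJ : ∀ a ∈ Ring.jacobson Λ, ∀ b ∈ Ring.jacobson Λ, a * b = 0)
    {x y : RepVariety P d} (hy : y ∈ stratum P d T)
    (hrad : ∀ i, Module.finrank K (radSpace x.1 i) ≤ Module.finrank K (radSpace y.1 i))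
    (hsoc : ∀ i, Module.finrank K (socSpace y.1 i) ≤ Module.finrank K (socSpace x.1 i)) :
    x ∈ closure (stratum P d T) := by
  choose B hxB hBx hB using fun i => exists_submodule_between_finrank_eq
    (RepVariety.radSpace_le_socSpace P hJ x i) (hrad i)
    ((Submodule.finrank_mono (RepVariety.radSpace_le_socSpace P hJ y i)).trans (hsoc i))
  refine mem_closure_iff.2 fun W hW hxW => ?_
  obtain ⟨U, hU, rfl⟩ := isOpen_induced_iff.1 hW
  obtain ⟨z, hz, -, hzU⟩ := exists_mem_stratum_of_mem_layer P hy hJ (fun i => (hB i).symm) hU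
    ⟨x.1, fun i => ⟨hxB i, hBx i⟩, hxW⟩
  exact ⟨z, hzU, hz⟩

theorem dimVec_mem_topSoc (x : RepVariety P d) :
    (dimVec P (top Λ (RepModule P x)), dimVec P (socle Λ (RepModule P x))) ∈ TopSoc P d :=
  ⟨RepModule P x, inferInstance, inferInstance, inferInstance, inferInstance,
    Module.Finite.of_restrictScalars_finite K Λ _, dimVec_repModule P x, rfl⟩

end Stratum

end

end QuiverRep

/-! ### The theorem -/

open QuiverRep in
theorem theorem3p6 {K : Type*} [Field K] [IsAlgClosed K]
    {V : Type*} [Quiver V] [Fintype V] [DecidableEq V] [∀ i j : V, Finite (i ⟶ j)]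
    {Λ : Type*} [Ring Λ] [Algebra K Λ] (P : QuiverRep.Presentation K V Λ)
    (hJ : ∀ a ∈ Ring.jacobson Λ, ∀ b ∈ Ring.jacobson Λ, a * b = 0)
    (d : V → ℕ)
    (T₁ : Type*) [AddCommGroup T₁] [Module K T₁] [Module Λ T₁] [IsScalarTower K Λ T₁]
    [Module.Finite Λ T₁] [IsSemisimpleModule Λ T₁]
    (T₂ : Type*) [AddCommGroup T₂] [Module K T₂] [Module Λ T₂] [IsScalarTower K Λ T₂]
    [Module.Finite Λ T₂] [IsSemisimpleModule Λ T₂]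
    (hT₁ : QuiverRep.IsRealizable P d T₁) (hT₂ : QuiverRep.IsRealizable P d T₂) :
    -- the generic socles of the two strata exist
    (∃ x ∈ QuiverRep.stratum P d T₁, QuiverRep.IsGenericSocle P (QuiverRep.stratum P d T₁)
      (QuiverRep.socle Λ (QuiverRep.RepModule P x))) ∧
    (∃ x ∈ QuiverRep.stratum P d T₂, QuiverRep.IsGenericSocle P (QuiverRep.stratum P d T₂)
      (QuiverRep.socle Λ (QuiverRep.RepModule P x))) ∧
    ∀ (U₁ : Type*) [AddCommGroup U₁] [Module K U₁] [Module Λ U₁] [IsScalarTower K Λ U₁]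
      (U₂ : Type*) [AddCommGroup U₂] [Module K U₂] [Module Λ U₂] [IsScalarTower K Λ U₂],
      QuiverRep.IsGenericSocle P (QuiverRep.stratum P d T₁) U₁ →
      QuiverRep.IsGenericSocle P (QuiverRep.stratum P d T₂) U₂ →
      (QuiverRep.dimVec P T₁, QuiverRep.dimVec P U₁) ∈ QuiverRep.TopSoc P d ∧
      (QuiverRep.dimVec P T₂, QuiverRep.dimVec P U₂) ∈ QuiverRep.TopSoc P d ∧
      (QuiverRep.stratum P d T₁ ⊆ closure (QuiverRep.stratum P d T₂) ↔
        (QuiverRep.dimVec P T₂, QuiverRep.dimVec P U₂) ≤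
          (QuiverRep.dimVec P T₁, QuiverRep.dimVec P U₁)) := by
  have : Infinite K := IsAlgClosed.instInfinite
  refine ⟨exists_isGenericSocle P hJ hT₁, exists_isGenericSocle P hJ hT₂, ?_⟩
  rintro U₁ _ _ _ _ U₂ _ _ _ _ ⟨O₁, ⟨W₁, hW₁, hO₁⟩, hd₁, hs₁⟩ ⟨O₂, ⟨W₂, hW₂, hO₂⟩, hd₂, hs₂⟩
  obtain ⟨x, hx⟩ : O₁.Nonempty := closure_nonempty_iff.1 (hT₁.mono hd₁)
  obtain ⟨y, hy⟩ : O₂.Nonempty := closure_nonempty_iff.1 (hT₂.mono hd₂)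
  have hxT : x ∈ stratum P d T₁ := (hO₁ ▸ hx).1
  have hyT : y ∈ stratum P d T₂ := (hO₂ ▸ hy).1
  have ht₁ : dimVec P (QuiverRep.top Λ (RepModule P x)) = dimVec P T₁ := dimVec_congr P hxT.some
  have ht₂ : dimVec P (QuiverRep.top Λ (RepModule P y)) = dimVec P T₂ := dimVec_congr P hyT.some
  have hsoc₁ : ∀ z ∈ O₁, ∀ i, Module.finrank K (socSpace z.1 i) = dimVec P U₁ i := fun z hz i =>
    (dimVec_socle_repModule P z i).symm.trans (congrFun (dimVec_congr P (hs₁ z hz).some) i)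
  have hsoc₂ : ∀ z ∈ O₂, ∀ i, Module.finrank K (socSpace z.1 i) = dimVec P U₂ i := fun z hz i =>
    (dimVec_socle_repModule P z i).symm.trans (congrFun (dimVec_congr P (hs₂ z hz).some) i)
  refine ⟨?_, ?_, fun h => ⟨fun i => ?_, fun i => ?_⟩, fun h => ?_⟩
  · rw [← ht₁, ← dimVec_congr P (hs₁ x hx).some]
    exact dimVec_mem_topSoc P x
  · rw [← ht₂, ← dimVec_congr P (hs₂ y hy).some]
    exact dimVec_mem_topSoc P y
  · have hle := finrank_radSpace_le_of_mem_closure P hyT (h hxT) i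
    have h₁ := dimVec_top_add_finrank_radSpace P x i
    have h₂ := dimVec_top_add_finrank_radSpace P y i
    rw [ht₁] at h₁
    rw [ht₂] at h₂
    change dimVec P T₂ i ≤ dimVec P T₁ i
    omega
  -- Since `O₂` is dense in its stratum, `x` lies in the closure of `O₂`, where the socle dimensions
  -- are at least those of `U₂`.
  · refine (le_finrank_socSpace_of_mem_closure P (fun z hz => (hsoc₂ z hz i).ge)
      (closure_minimal hd₂ isClosed_closure (h hxT))).trans (hsoc₁ x hx i).le
  -- It suffices to treat the points of the dense subset `O₁`, since only their socle dimensions are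
  -- known to be those of `U₁`.
  · refine hd₁.trans (closure_minimal (fun z hz => ?_) isClosed_closure)
    have hzT : z ∈ stratum P d T₁ := (hO₁ ▸ hz).1
    refine mem_closure_stratum P hJ hyT (fun i => ?_) fun i => ?_
    · have h₁ := dimVec_top_add_finrank_radSpace P x i
      have h₂ := dimVec_top_add_finrank_radSpace P y i
      rw [ht₁] at h₁
      rw [ht₂] at h₂
      rw [(mem_stratum_iff P hxT z).1 hzT i]
      have : dimVec P T₂ i ≤ dimVec P T₁ i := h.1 i
      omega
    · rw [hsoc₁ z hz, hsoc₂ y hy]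
      exact h.2 i
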